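/- **Notation.** For a closed complex submanifold $X$ of some $\mathbb{C}^N$, an ordered tuple $(\theta_1,\dots,\theta_k)$ of $\mathbb{C}$-complete holomorphic vector fields on $X$ is called *compatible* if (1) there is a non-zero ideal $I\subset\mathcal{O}(X)$ with $I\subset\overline{\mathrm{span}\left(\prod_{i=1}^k\ker\theta_i\right)}$ (closure in the compact-open topology), and (2) there are a rooted tree with edges directed towards the root, a bijection $\pi$ from its vertices onto $\{\theta_1,\dots,\theta_k\}$ with $\pi(\mathrm{root})=\theta_1$, and, for every directed edge $v\to w$, a function $\epsilon(v,w)\in(\ker\pi(v)^2\setminus\ker\pi(v))\cap\ker\pi(w)$ in $\mathcal{O}(X)$. Let $n,K\ge 2$, $m=n(n+1)/2$. For symmetric $n\times n$ matrices $Z_k=(z_{k,ij})$ put $M_k(Z_k)=\begin{pmatrix}I_n&0\\Z_k&I_n\end{pmatrix}$ for $k$ odd, $M_k(Z_k)=\begin{pmatrix}I_n&Z_k\\0&I_n\end{pmatrix}$ for $k$ even, and $P^k=(P^k_1,\dots,P^k_{2n})=e_{2n}^T M_1(Z_1)\cdots M_k(Z_k)$. These depend on $Z_1$ only through its last row $(z_{1,n1},\dots,z_{1,nn})$.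 Let $p=(P^K_{n+1},\dots,P^K_{2n})$ if $K$ is even and $p=(P^K_1,\dots,P^K_n)$ if $K$ is odd, and for $a\in\mathbb{C}^n\setminus\{0\}$ let $$\mathcal{G}_{K,a}=\{Z\in\mathbb{C}^n\times(\mathbb{C}^m)^{K-1}: p(Z)=a\}.$$ It is called smooth if the differential of $p$ is surjective at each of its points. **Theorem.** Let $K\ge2$, $n\ge2$, $a\in\mathbb{C}^n\setminus\{0\}$, and let $\mathcal{G}=\mathcal{G}_{K,a}$ be smooth. Then there is a compatible $k$-tuple on $\mathcal{G}$ with $k=2$ or $k=3$. More precisely, let $V=D_y(p)$ with $y=(y_0,\dots,y_n)=(z_{1,n1},\dots,z_{1,nn},z_{2,11})$, that is, $V=\det\begin{pmatrix}\partial/\partial y_0&\cdots&\partial/\partial y_n\\ \partial p_1/\partial y_0&\cdots&\partial p_1/\partial y_n\\ \vdots&&\vdots\\ \partial p_n/\partial y_0&\cdots&\partial p_n/\partial y_n\end{pmatrix}$. The following fields restrict to $\mathbb{C}$-complete holomorphic vector fields on $\mathcal{G}$ and form compatible tuples: 1. If $n\ge3$: the pair $(V,\gamma)$, where $\gamma=z_{1,n3}^2\,\partial_{z_{2,22}}-z_{1,n2}z_{1,n3}\,\partial_{z_{2,23}}+z_{1,n2}^2\,\partial_{z_{2,33}}$.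 2. If $n=2$ and $K\ge3$: the pair $(V,\tilde\gamma)$, where $\tilde\gamma=(P^2_{n+2})^2\,\partial_{z_{3,11}}-P^2_{n+1}P^2_{n+2}\,\partial_{z_{3,12}}+(P^2_{n+1})^2\,\partial_{z_{3,22}}$. 3. If $n=K=2$: with $(z_2,z_3)=(z_{1,21},z_{1,22})$, $(w_1,w_2,w_3)=(z_{2,11},z_{2,12},z_{2,22})$ and $b=a-(0,1)^T$ one has $b\ne0$ and $$\mathcal{G}=\left\{\begin{pmatrix}w_1&w_2\\w_2&w_3\end{pmatrix}\begin{pmatrix}z_2\\z_3\end{pmatrix}=\begin{pmatrix}b_1\\b_2\end{pmatrix}\right\},$$ and the triple $(V_1,V_2,V_3)$ is compatible, where $V_1=-z_2w_3\,\partial_{z_2}+z_2w_2\,\partial_{z_3}+(w_1w_3-w_2^2)\,\partial_{w_1}$, $V_2=z_3^2\,\partial_{w_1}-z_2z_3\,\partial_{w_2}+z_2^2\,\partial_{w_3}$, $V_3=z_3^2\,\partial_{z_2}-w_1z_3\,\partial_{w_2}+(w_1z_2-w_2z_3)\,\partial_{w_3}$. -/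

import Mathlib

open Topology

/-! ### Holomorphic functions and vector fields on a closed complex submanifold `X ⊆ ℂ^ι` -/

section Holomorphic

variable {ι : Type} [Fintype ι]

/-- A function `f : X → ℂ` on a subset `X` of `ℂ^ι` is holomorphic if near each point of `X` it is
the restriction of a holomorphic (i.e. analytic) function of the ambient space. For a complex
submanifold `X` these are the functions that are holomorphic in the charts of `X`. -/
def IsHolo {X : Set (ι → ℂ)} (f : X → ℂ) : Prop :=
  ∀ x : X, ∃ F : (ι → ℂ) → ℂ, AnalyticAt ℂ F x ∧ ∀ᶠ y : X in 𝓝 x, f y = F y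

theorem IsHolo.continuous {X : Set (ι → ℂ)} {f : X → ℂ} (hf : IsHolo f) : Continuous f := by
  rw [continuous_iff_continuousAt]
  intro x
  obtain ⟨F, hF, h⟩ := hf x
  exact ContinuousAt.congr (f := fun y : X => F y)
    (ContinuousAt.comp (g := F) hF.continuousAt continuous_subtype_val.continuousAt)
    (h.mono fun y hy => hy.symm)

/-- The algebra `𝒪(X)` of holomorphic functions on `X`. As a subtype of `C(X, ℂ)` it carries the
compact-open topology. -/
def HoloFun (X : Set (ι → ℂ)) : Subalgebra ℂ C(X, ℂ) where
  carrier := {f | IsHolo (f : X → ℂ)}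
  mul_mem' := by
    intro f g hf hg x
    obtain ⟨F, hF, h⟩ := hf x
    obtain ⟨G, hG, h'⟩ := hg x
    refine ⟨F * G, hF.mul hG, ?_⟩
    filter_upwards [h, h'] with y h1 h2
    simp [h1, h2]
  add_mem' := by
    intro f g hf hg x
    obtain ⟨F, hF, h⟩ := hf x
    obtain ⟨G, hG, h'⟩ := hg x
    refine ⟨F + G, hF.add hG, ?_⟩
    filter_upwards [h, h'] with y h1 h2
    simp [h1, h2]
  algebraMap_mem' := fun c x => ⟨fun _ => c, analyticAt_const, by simp⟩

/-- The holomorphic tangent space of `X` at `x`: the vectors that annihilate every germ of a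
holomorphic function vanishing on `X`. For a complex submanifold it is `T_x X`. -/
def holoTangent (X : Set (ι → ℂ)) (x : X) : Set (ι → ℂ) :=
  {v | ∀ F : (ι → ℂ) → ℂ, AnalyticAt ℂ F x → (∀ᶠ y : X in 𝓝 x, F y = 0) →
    fderiv ℂ F x v = 0}

/-- A holomorphic vector field on `X`. -/
structure HoloVF (X : Set (ι → ℂ)) where
  toFun : X → (ι → ℂ)
  holo : ∀ c, IsHolo fun x => toFun x c
  tangent : ∀ x, toFun x ∈ holoTangent X x

/-- The value at `x` of the derivative `θ(f)`: the differential of a local holomorphic extension of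
`f`, applied to `θ(x)`. -/
noncomputable def HoloVF.applyFun {X : Set (ι → ℂ)} (θ : HoloVF X) (f : HoloFun X) (x : X) : ℂ :=
  fderiv ℂ (f.2 x).choose x (θ.toFun x)

/-- `θ(f)(x)` does not depend on the local extension. -/
theorem HoloVF.applyFun_eq {X : Set (ι → ℂ)} (θ : HoloVF X) (f : HoloFun X) (x : X)
    {F : (ι → ℂ) → ℂ} (hF : AnalyticAt ℂ F x) (h : ∀ᶠ y : X in 𝓝 x, (f : C(X, ℂ)) y = F y) :
    θ.applyFun f x = fderiv ℂ F x (θ.toFun x) := by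
  obtain ⟨hG, hG'⟩ := (f.2 x).choose_spec
  have := θ.tangent x ((f.2 x).choose - F) (hG.sub hF) (by
    filter_upwards [h, hG'] with y h1 h2
    rw [Pi.sub_apply, ← h1, ← h2, sub_self])
  rw [fderiv_sub hG.differentiableAt hF.differentiableAt] at this
  exact sub_eq_zero.1 this

theorem HoloVF.isHolo_applyFun {X : Set (ι → ℂ)} (θ : HoloVF X) (f : HoloFun X) :
    IsHolo (θ.applyFun f) := by
  intro x
  obtain ⟨F, hF, h⟩ := f.2 x
  choose W hW hW' using fun c => θ.holo c x
  refine ⟨fun y => fderiv ℂ F y (fun c => W c y), ?_, ?_⟩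
  · exact (ContinuousLinearMap.analyticAt_bilinear
      (ContinuousLinearMap.id ℂ ((ι → ℂ) →L[ℂ] ℂ)) (fderiv ℂ F x, fun c => W c x)).comp₂
      hF.fderiv (AnalyticAt.pi hW)
  have h1 : ∀ᶠ y : X in 𝓝 x, AnalyticAt ℂ F y :=
    continuous_subtype_val.continuousAt.eventually hF.eventually_analyticAt
  filter_upwards [h1, eventually_eventually_nhds.2 h, Filter.eventually_all.2 hW'] with y a b c
  rw [θ.applyFun_eq f y a b]
  exact congrArg _ (funext c)

/-- The action `f ↦ θ(f)` of a holomorphic vector field on `𝒪(X)`. -/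
noncomputable def HoloVF.apply {X : Set (ι → ℂ)} (θ : HoloVF X) (f : HoloFun X) : HoloFun X :=
  ⟨⟨θ.applyFun f, (θ.isHolo_applyFun f).continuous⟩, θ.isHolo_applyFun f⟩

/-- `ker θ`. -/
def HoloVF.ker {X : Set (ι → ℂ)} (θ : HoloVF X) : Set (HoloFun X) := {f | θ.apply f = 0}

/-- `ker θ²`. -/
def HoloVF.kerSq {X : Set (ι → ℂ)} (θ : HoloVF X) : Set (HoloFun X) :=
  {f | θ.apply (θ.apply f) = 0}

/-- `θ` is `ℂ`-complete: through every point of `X` there is an integral curve in `X` that is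
defined for all complex times. -/
def HoloVF.IsComplete {X : Set (ι → ℂ)} (θ : HoloVF X) : Prop :=
  ∀ x : X, ∃ φ : ℂ → X, φ 0 = x ∧
    ∀ t, HasDerivAt (fun s => (φ s : ι → ℂ)) (θ.toFun (φ t)) t

/-- The ordered tuple `θ = (θ 0, …, θ k)` of holomorphic vector fields on `X` is compatible.
The rooted directed tree is given by a tree `T` with a root `r`; its directed edges `v ⟶ w`
are the edges of `T` oriented towards the root. -/
def IsCompatibleTuple {X : Set (ι → ℂ)} {k : ℕ} (θ : Fin (k + 1) → HoloVF X) : Prop :=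
  (∀ i, (θ i).IsComplete) ∧
  (∃ I : Ideal (HoloFun X), I ≠ ⊥ ∧
    (I : Set (HoloFun X)) ⊆ closure (Submodule.span ℂ
      {g | ∃ f : Fin (k + 1) → HoloFun X, (∀ i, f i ∈ (θ i).ker) ∧ g = ∏ i, f i} :
        Set (HoloFun X))) ∧
  (∃ (Vert : Type) (T : SimpleGraph Vert) (r : Vert) (π : Vert ≃ Set.range θ)
      (ε : Vert → Vert → HoloFun X),
    T.IsTree ∧ (π r : HoloVF X) = θ 0 ∧
    ∀ v w, T.Adj v w → T.dist w r < T.dist v r →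
      ε v w ∈ ((π v : HoloVF X).kerSq \ (π v : HoloVF X).ker) ∩ (π w : HoloVF X).ker)

/-- The vector field
`D_y(p) = det (∂/∂y_0 … ∂/∂y_l ; ∂p_1/∂y_0 … ∂p_1/∂y_l ; … ; ∂p_l/∂y_0 … ∂p_l/∂y_l)` on `ℂ^ι`;
its component at a coordinate `c` is obtained by applying the first row to that coordinate. -/
noncomputable def jacobianField [DecidableEq ι] {l : ℕ} (p : (ι → ℂ) → (Fin l → ℂ))
    (y : Fin (l + 1) → ι) (x : ι → ℂ) : ι → ℂ := fun c =>
  Matrix.det (Matrix.of (Fin.cons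
    (fun j => (Pi.single (y j) 1 : ι → ℂ) c)
    (fun i j => fderiv ℂ (fun x' => p x' i) x (Pi.single (y j) 1))) :
      Matrix (Fin (l + 1)) (Fin (l + 1)) ℂ)

end Holomorphic

/-! ### The symplectic Gromov–Vaserstein varieties -/

/-- The symmetric matrix with entries `z_{ij} = z_{ji}`. -/
def symMatrix {n : ℕ} (z : Sym2 (Fin n) → ℂ) : Matrix (Fin n) (Fin n) ℂ :=
  Matrix.of fun i j => z s(i, j)

/-- The elementary symplectic matrix `M_k(Z)`, upper triangular for even `k` and lower triangular
for odd `k`. -/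
def elemMatrix {n : ℕ} (k : ℕ) (z : Sym2 (Fin n) → ℂ) :
    Matrix (Fin n ⊕ Fin n) (Fin n ⊕ Fin n) ℂ :=
  if Even k then Matrix.fromBlocks 1 (symMatrix z) 0 1 else Matrix.fromBlocks 1 0 (symMatrix z) 1

/-- The last standard basis vector `e_n` of `ℂ^n`. -/
def lastVec (n : ℕ) : Fin n → ℂ := fun j => if (j : ℕ) + 1 = n then 1 else 0

/-- `gvMap Z k = e_{2n}ᵀ M_1(Z_1) ⋯ M_k(Z_k)`, with entries `inl j` (first half) and
`inr j` (second half). -/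
def gvMap {n : ℕ} (Z : ℕ → Sym2 (Fin n) → ℂ) : ℕ → (Fin n ⊕ Fin n → ℂ)
  | 0 => Sum.elim 0 (lastVec n)
  | k + 1 => Matrix.vecMul (gvMap Z k) (elemMatrix (k + 1) (Z (k + 1)))

/-- The coordinates of `ℂ^n × (ℂ^m)^(K-1)`, `m = n(n+1)/2`: `inl j` is `z_{1,nj}` and
`inr (k, s(i, j))` is `z_{k,ij}`, `2 ≤ k ≤ K`. -/
abbrev GVIndex (n K : ℕ) : Type := Fin n ⊕ (Set.Icc 2 K × Sym2 (Fin n))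

/-- The sequence `Z_1, …, Z_K` of symmetric matrices belonging to a point of `ℂ^n × (ℂ^m)^(K-1)`.
The last row of `Z_1` is given by the first `n` coordinates. The other entries of `Z_1` do not
enter `gvMap Z K` (see `gvMap_congr`) and are set to `0`. -/
def gvSeq {n K : ℕ} (x : GVIndex n K → ℂ) (k : ℕ) : Sym2 (Fin n) → ℂ :=
  if h : k ∈ Set.Icc 2 K then fun e => x (Sum.inr (⟨k, h⟩, e))
  else if k = 1 then
    Sym2.lift ⟨fun i j => if (i : ℕ) + 1 = n then x (Sum.inl j)
        else if (j : ℕ) + 1 = n then x (Sum.inl i) else 0, by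
      intro i j
      by_cases hi : (i : ℕ) + 1 = n <;> by_cases hj : (j : ℕ) + 1 = n
      · have : i = j := Fin.ext (by omega)
        subst this
        rfl
      all_goals simp [hi, hj]⟩
  else 0

theorem gvMap_one {n : ℕ} (Z : ℕ → Sym2 (Fin n) → ℂ) :
    gvMap Z 1 = Sum.elim (Matrix.vecMul (lastVec n) (symMatrix (Z 1))) (lastVec n) := by
  simp [gvMap, elemMatrix, Matrix.vecMul_fromBlocks]

/-- `e_{2n}ᵀ M_1(Z_1) ⋯ M_k(Z_k)` depends on `Z_1` only through its last row. -/
theorem gvMap_congr {n : ℕ} (Z Z' : ℕ → Sym2 (Fin n) → ℂ)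
    (h1 : ∀ i j : Fin n, (i : ℕ) + 1 = n → Z 1 s(i, j) = Z' 1 s(i, j))
    (h2 : ∀ k, 2 ≤ k → Z k = Z' k) (k : ℕ) : gvMap Z k = gvMap Z' k := by
  induction k with
  | zero => rfl
  | succ k ih =>
    rcases Nat.eq_zero_or_pos k with rfl | hk
    · rw [gvMap_one, gvMap_one]
      congr 1
      ext j
      unfold Matrix.vecMul dotProduct
      refine Finset.sum_congr rfl fun i _ => ?_
      by_cases hi : (i : ℕ) + 1 = n
      · simp [symMatrix, h1 i j hi]
      · simp [lastVec, hi]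
    · rw [gvMap, gvMap, ih, h2 (k + 1) (by omega)]

/-- The defining polynomials of the variety: the second half of `P^K` for even `K`, the first half
for odd `K`. -/
def gvPoly (n K : ℕ) (x : GVIndex n K → ℂ) : Fin n → ℂ := fun j =>
  if Even K then gvMap (gvSeq x) K (Sum.inr j) else gvMap (gvSeq x) K (Sum.inl j)

/-- The symplectic Gromov–Vaserstein variety `𝒢_{K,a} ⊆ ℂ^n × (ℂ^m)^(K-1)`. -/
def gvVariety (n K : ℕ) (a : Fin n → ℂ) : Set (GVIndex n K → ℂ) := {x | gvPoly n K x = a}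

/-- `𝒢_{K,a}` is smooth: the differential of the defining map `ℂ^n × (ℂ^m)^(K-1) → ℂ^n` is
surjective at each of its points. -/
def GVSmooth (n K : ℕ) (a : Fin n → ℂ) : Prop :=
  ∀ x ∈ gvVariety n K a, Function.Surjective (fderiv ℂ (gvPoly n K) x)

section Fields

variable {n K : ℕ}

/-- The coordinate `z_{1,n(j+1)}` (`Fin n` is zero-based). -/
def zIdx (K : ℕ) (j : ℕ) (hj : j < n) : GVIndex n K := Sum.inl ⟨j, hj⟩

/-- The coordinate `z_{k,(i+1)(j+1)}`. -/
def wIdx (k i j : ℕ) (hk : 2 ≤ k ∧ k ≤ K) (hi : i < n) (hj : j < n) : GVIndex n K :=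
  Sum.inr (⟨k, hk⟩, s(⟨i, hi⟩, ⟨j, hj⟩))

/-- The coordinate vector field `∂/∂c`. -/
def coordVec (c : GVIndex n K) : GVIndex n K → ℂ := Pi.single c 1

/-- `V = D_y(P_s^K)` (`K` even) or `D_y(P_f^K)` (`K` odd), with
`y = (z_{1,n1}, …, z_{1,nn}, z_{2,11})`. -/
noncomputable def fieldV (hn : 2 ≤ n) (hK : 2 ≤ K) : (GVIndex n K → ℂ) → (GVIndex n K → ℂ) :=
  jacobianField (gvPoly n K)
    (Fin.snoc (fun j : Fin n => zIdx K j j.2) (wIdx 2 0 0 (by omega) (by omega) (by omega)))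

/-- `γ = z_{1,n3}² ∂/∂z_{2,22} − z_{1,n2} z_{1,n3} ∂/∂z_{2,23} + z_{1,n2}² ∂/∂z_{2,33}`. -/
def fieldGamma (hn : 3 ≤ n) (hK : 2 ≤ K) (x : GVIndex n K → ℂ) : GVIndex n K → ℂ :=
  let z₂ := x (zIdx K 1 (by omega))
  let z₃ := x (zIdx K 2 (by omega))
  z₃ ^ 2 • coordVec (wIdx 2 1 1 (by omega) (by omega) (by omega))
    - (z₂ * z₃) • coordVec (wIdx 2 1 2 (by omega) (by omega) (by omega))
    + z₂ ^ 2 • coordVec (wIdx 2 2 2 (by omega) (by omega) (by omega))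

/-- `γ̃ = (P²_{n+2})² ∂/∂z_{3,11} − P²_{n+1} P²_{n+2} ∂/∂z_{3,12} + (P²_{n+1})² ∂/∂z_{3,22}`. -/
def fieldGammaTilde (hn : 2 ≤ n) (hK : 3 ≤ K) (x : GVIndex n K → ℂ) : GVIndex n K → ℂ :=
  let q₁ := gvMap (gvSeq x) 2 (Sum.inr ⟨0, by omega⟩)
  let q₂ := gvMap (gvSeq x) 2 (Sum.inr ⟨1, by omega⟩)
  q₂ ^ 2 • coordVec (wIdx 3 0 0 (by omega) (by omega) (by omega))
    - (q₁ * q₂) • coordVec (wIdx 3 0 1 (by omega) (by omega) (by omega))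
    + q₁ ^ 2 • coordVec (wIdx 3 1 1 (by omega) (by omega) (by omega))

/- For `n = K = 2` we use the coordinates `(z₂, z₃, w₁, w₂, w₃)`. -/

/-- `z₂ = z_{1,21}`. -/
def idxZ2 (hn : 2 ≤ n) : GVIndex n K := zIdx K 0 (by omega)

/-- `z₃ = z_{1,22}`. -/
def idxZ3 (hn : 2 ≤ n) : GVIndex n K := zIdx K 1 (by omega)

/-- `w₁ = z_{2,11}`. -/
def idxW1 (hn : 2 ≤ n) (hK : 2 ≤ K) : GVIndex n K :=
  wIdx 2 0 0 (by omega) (by omega) (by omega)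

/-- `w₂ = z_{2,12}`. -/
def idxW2 (hn : 2 ≤ n) (hK : 2 ≤ K) : GVIndex n K :=
  wIdx 2 0 1 (by omega) (by omega) (by omega)

/-- `w₃ = z_{2,22}`. -/
def idxW3 (hn : 2 ≤ n) (hK : 2 ≤ K) : GVIndex n K :=
  wIdx 2 1 1 (by omega) (by omega) (by omega)

/-- `V₁ = −z₂w₃ ∂/∂z₂ + z₂w₂ ∂/∂z₃ + (w₁w₃ − w₂²) ∂/∂w₁`. -/
def fieldV1 (hn : 2 ≤ n) (hK : 2 ≤ K) (x : GVIndex n K → ℂ) : GVIndex n K → ℂ :=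
  let z₂ := x (idxZ2 hn)
  let w₁ := x (idxW1 hn hK)
  let w₂ := x (idxW2 hn hK)
  let w₃ := x (idxW3 hn hK)
  (-(z₂ * w₃)) • coordVec (idxZ2 hn) + (z₂ * w₂) • coordVec (idxZ3 hn)
    + (w₁ * w₃ - w₂ ^ 2) • coordVec (idxW1 hn hK)

/-- `V₂ = z₃² ∂/∂w₁ − z₂z₃ ∂/∂w₂ + z₂² ∂/∂w₃`. -/
def fieldV2 (hn : 2 ≤ n) (hK : 2 ≤ K) (x : GVIndex n K → ℂ) : GVIndex n K → ℂ :=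
  let z₂ := x (idxZ2 hn)
  let z₃ := x (idxZ3 hn)
  z₃ ^ 2 • coordVec (idxW1 hn hK) - (z₂ * z₃) • coordVec (idxW2 hn hK)
    + z₂ ^ 2 • coordVec (idxW3 hn hK)

/-- `V₃ = z₃² ∂/∂z₂ − w₁z₃ ∂/∂w₂ + (w₁z₂ − w₂z₃) ∂/∂w₃`. -/
def fieldV3 (hn : 2 ≤ n) (hK : 2 ≤ K) (x : GVIndex n K → ℂ) : GVIndex n K → ℂ :=
  let z₂ := x (idxZ2 hn)
  let z₃ := x (idxZ3 hn)
  let w₁ := x (idxW1 hn hK)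
  let w₂ := x (idxW2 hn hK)
  z₃ ^ 2 • coordVec (idxZ2 hn) - (w₁ * z₃) • coordVec (idxW2 hn hK)
    + (w₁ * z₂ - w₂ * z₃) • coordVec (idxW3 hn hK)

end Fields

/-! The proof reduces compatibility to statements about coordinate functions. If every coordinate is
killed by one of the fields, grouping the factors of a monomial shows that all polynomials lie in
the span of the products of kernels (`polyFun_mem_span_prod_ker`). It then suffices to find one
nonzero function `h` such that `h * f` is a limit of polynomials for every holomorphic `f`; the
ideal generated by `h` does the rest. The tree is a star with root `θ 0`. An edge needs only a
coordinate that `θ 0` kills and whose derivative along `θ i` is nonzero but constant along the flow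
of `θ i` (`isCompatibleTuple_of_coordFun`).

The multiplier `h` exists on every nonempty affine algebraic set
(`exists_ne_zero_mul_mem_closure_polyFun`). Noether normalization presents an irreducible component
as a branched cover of `ℂ^s`, generated generically by a root `θ` of a monic polynomial `m`. The
traces of `f * θ^l` over the fibres, multiplied by the square of a denominator `G`, are entire on
`ℂ^s`, hence limits of polynomials. Lagrange interpolation recovers `G² m'(θ) f` from these traces.
A factor vanishing on the other components globalizes the result.

The fields are tangent and complete for two reasons. For `V`, a determinant with two equal rows
gives tangency. On slices where only `y` varies, the equations are affine in `(y_0, …, y_{n-1}, y_0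
y_n)`, so the flow equations become linear (`exists_flow_fieldV`). For `γ`, `γ̃` and `V₂`, the field
adds to `Z_k` a rank one matrix `u uᵀ` with `u` orthogonal to the half of `P^{k-1}` that multiplies
`Z_k`; this leaves `P^k` unchanged, and the flow lines are straight (`gvPoly_add_smul_pencilField`).

The pairs move disjoint sets of coordinates. For `n = K = 2`, both `V₁` and `V₂` move `w₁`, so a
third field `V₃` killing `w₁` is added; its flow is quadratic in time. -/

/-! ### Polynomial approximation of entire functions of several variables -/

section Entire

/-- The iterated divided differences of `g` with nodes `t 0, t 1, …`. -/
noncomputable def newtonRem (t : ℕ → ℂ) (g : ℂ → ℂ) : ℕ → ℂ → ℂ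
  | 0 => g
  | k + 1 => dslope (newtonRem t g k) (t k)

theorem differentiable_dslope {g : ℂ → ℂ} (hg : Differentiable ℂ g) (c : ℂ) :
    Differentiable ℂ (dslope g c) := by
  rw [← differentiableOn_univ] at hg ⊢
  exact (Complex.differentiableOn_dslope Filter.univ_mem).2 hg

theorem differentiable_newtonRem (t : ℕ → ℂ) {g : ℂ → ℂ} (hg : Differentiable ℂ g) (k : ℕ) :
    Differentiable ℂ (newtonRem t g k) := by
  induction k with
  | zero => exact hg
  | succ k ih => exact differentiable_dslope ih _

/-- By the maximum principle the bound is needed only on `‖w‖ = 9R`, where `‖w - t‖ ≥ 8R` and the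
numerator is at most `2M`. The radius does not shrink, so the estimate can be iterated. -/
theorem norm_dslope_le {g : ℂ → ℂ} (hg : Differentiable ℂ g) {R M : ℝ} (hR : 0 < R) {t : ℂ}
    (ht : ‖t‖ ≤ R) (hM : ∀ z, ‖z‖ ≤ 9 * R → ‖g z‖ ≤ M) (z : ℂ) (hz : ‖z‖ ≤ 9 * R) :
    ‖dslope g t z‖ ≤ M / (4 * R) := by
  refine Complex.norm_le_of_forall_mem_frontier_norm_le (U := Metric.ball 0 (9 * R))
    Metric.isBounded_ball (differentiable_dslope hg t).diffContOnCl ?_ ?_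
  · intro w hw
    rw [frontier_ball _ (by positivity), mem_sphere_zero_iff_norm] at hw
    have h8 : 8 * R ≤ ‖w - t‖ := by
      have := norm_sub_norm_le w t
      linarith
    have hne : w ≠ t := by
      rintro rfl
      simp only [sub_self, norm_zero] at h8
      linarith
    rw [dslope_of_ne _ hne, slope_def_field, norm_div]
    have h1 : ‖g w - g t‖ ≤ M + M :=
      (norm_sub_le _ _).trans (add_le_add (hM w hw.le) (hM t (by linarith)))
    rw [div_le_div_iff₀ (by linarith) (by positivity)]
    have hM0 : 0 ≤ M := (norm_nonneg _).trans (hM w hw.le)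
    nlinarith
  · rw [closure_ball _ (by positivity)]
    simpa using hz

theorem norm_newtonRem_le (t : ℕ → ℂ) {g : ℂ → ℂ} (hg : Differentiable ℂ g) {R M : ℝ} (hR : 0 < R)
    (ht : ∀ k, ‖t k‖ ≤ R) (hM : ∀ z, ‖z‖ ≤ 9 * R → ‖g z‖ ≤ M) (k : ℕ) (z : ℂ)
    (hz : ‖z‖ ≤ 9 * R) : ‖newtonRem t g k z‖ ≤ M / (4 * R) ^ k := by
  induction k generalizing z with
  | zero => simpa [newtonRem] using hM z hz
  | succ k ih =>
    rw [pow_succ, ← div_div]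
    exact norm_dslope_le (differentiable_newtonRem t hg k) hR (ht k) (fun z hz => ih z hz) z hz

theorem newton_interpolation (t : ℕ → ℂ) (g : ℂ → ℂ) (N : ℕ) (z : ℂ) :
    g z = ∑ k ∈ Finset.range N, newtonRem t g k (t k) * ∏ j ∈ Finset.range k, (z - t j)
      + newtonRem t g N z * ∏ j ∈ Finset.range N, (z - t j) := by
  induction N with
  | zero => simp [newtonRem]
  | succ N ih =>
    rw [Finset.sum_range_succ, Finset.prod_range_succ]
    conv_lhs => rw [ih]
    have h := sub_smul_dslope (newtonRem t g N) (t N) z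
    simp only [smul_eq_mul] at h
    simp only [newtonRem]
    linear_combination (-∏ j ∈ Finset.range N, (z - t j)) * h

/-- The nodes are distinct, so the divided differences needed at later nodes are honest difference
quotients of values of `G y`. No derivative in `z` appears, and dependence on the parameter is
differentiable by arithmetic alone. -/
theorem differentiable_newtonRem_param {E : Type*} [NormedAddCommGroup E] [NormedSpace ℂ E]
    (t : ℕ → ℂ) {G : E → ℂ → ℂ} (hG : ∀ z, Differentiable ℂ fun y => G y z) (k : ℕ) (z : ℂ)
    (hz : ∀ j < k, z ≠ t j) (ht : Function.Injective t) :
    Differentiable ℂ fun y => newtonRem t (G y) k z := by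
  induction k generalizing z with
  | zero => exact hG z
  | succ k ih =>
    have h := hz k (Nat.lt_succ_self k)
    simp only [newtonRem, dslope_of_ne _ h, slope_def_field]
    have h1 := ih z fun j hj => hz j (by omega)
    have h2 := ih (t k) fun j hj he => absurd (ht he) (by omega)
    fun_prop

/-- Induction on the number of variables: Newton interpolation in the first variable has
coefficients that are entire in the others. The remainder is at most `M / (4R)^N` times `(2R)^N`,
that is `M / 2^N`, uniformly in the remaining variables. -/
theorem exists_mvPolynomial_near_of_differentiable {s : ℕ} {F : (Fin s → ℂ) → ℂ}
    (hF : Differentiable ℂ F) {R : ℝ} (hR : 1 ≤ R) {ε : ℝ} (hε : 0 < ε) :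
    ∃ p : MvPolynomial (Fin s) ℂ, ∀ y, ‖y‖ ≤ R → ‖F y - MvPolynomial.eval y p‖ < ε := by
  induction s generalizing ε with
  | zero =>
    refine ⟨MvPolynomial.C (F 0), fun y _ => ?_⟩
    simpa [Subsingleton.elim y 0] using hε
  | succ s ih =>
    -- Any injective sequence in the unit disc would serve; `1 ≤ R` puts the nodes in the disc of
    -- radius `R`.
    let t : ℕ → ℂ := fun k => ((k : ℂ) + 1)⁻¹
    have ht : Function.Injective t := fun i j h => by
      have := inv_injective h
      exact_mod_cast add_right_cancel this
    have htR : ∀ k, ‖t k‖ ≤ R := fun k => by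
      refine le_trans ?_ hR
      rw [norm_inv]
      refine inv_le_one_of_one_le₀ ?_
      have : ((k : ℂ) + 1) = ((k + 1 : ℕ) : ℂ) := by push_cast; rfl
      rw [this, Complex.norm_natCast]
      exact_mod_cast Nat.succ_le_succ (Nat.zero_le k)
    obtain ⟨M, hM⟩ := (isCompact_closedBall (0 : Fin (s + 1) → ℂ) (9 * R)).exists_bound_of_continuousOn
      hF.continuous.continuousOn
    let G : (Fin s → ℂ) → ℂ → ℂ := fun y z => F (Fin.cons z y)
    have hcons : Differentiable ℂ fun p : ℂ × (Fin s → ℂ) => (Fin.cons p.1 p.2 : Fin (s + 1) → ℂ) := by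
      rw [differentiable_pi]
      intro i
      refine Fin.cases ?_ (fun i => ?_) i
      · simp only [Fin.cons_zero]
        fun_prop
      · simp only [Fin.cons_succ]
        fun_prop
    have hG1 : ∀ z, Differentiable ℂ fun y => G y z := fun z =>
      hF.comp (hcons.comp ((differentiable_const z).prodMk differentiable_id))
    have hG2 : ∀ y, Differentiable ℂ (G y) := fun y =>
      hF.comp (hcons.comp (differentiable_id.prodMk (differentiable_const y)))
    have hM' : ∀ y, ‖y‖ ≤ R → ∀ z, ‖z‖ ≤ 9 * R → ‖G y z‖ ≤ M := by
      intro y hy z hz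
      refine hM _ ?_
      rw [mem_closedBall_zero_iff, pi_norm_le_iff_of_nonneg (by linarith)]
      intro i
      refine Fin.cases ?_ (fun i => ?_) i
      · simpa using hz
      · simpa using (norm_le_pi_norm y i).trans (hy.trans (by linarith))
    have hM0 : 0 ≤ M := (norm_nonneg _).trans (hM' 0 (by simpa using by linarith) 0
      (by simpa using by linarith))
    obtain ⟨N, hN⟩ := exists_pow_lt_of_lt_one (show 0 < ε / (2 * (M + 1)) by positivity)
      (show (1 / 2 : ℝ) < 1 by norm_num)
    -- `S` bounds the total size of the Newton basis polynomials on the ball, so coefficient errors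
    -- below `ε / (2(S+1))` cost less than `ε / 2`.
    set S : ℝ := ∑ k ∈ Finset.range N, (2 * R) ^ k with hS
    have hS0 : 0 ≤ S := Finset.sum_nonneg fun k _ => by positivity
    have hε' : 0 < ε / (2 * (S + 1)) := by positivity
    choose p hp using fun k => ih (F := fun y => newtonRem t (G y) k (t k))
      (differentiable_newtonRem_param t hG1 k (t k) (fun j hj he => absurd (ht he) (by omega)) ht) hε'
    refine ⟨∑ k ∈ Finset.range N, MvPolynomial.rename Fin.succ (p k) *
      ∏ j ∈ Finset.range k, (MvPolynomial.X 0 - MvPolynomial.C (t j)), fun y hy => ?_⟩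
    have hy0 : ‖y 0‖ ≤ R := (norm_le_pi_norm y 0).trans hy
    have hyt : ‖Fin.tail y‖ ≤ R := by
      rw [pi_norm_le_iff_of_nonneg (by linarith)]
      exact fun i => (norm_le_pi_norm y i.succ).trans hy
    have hprod : ∀ k, ‖∏ j ∈ Finset.range k, (y 0 - t j)‖ ≤ (2 * R) ^ k := fun k => by
      rw [norm_prod]
      refine (Finset.prod_le_prod (fun _ _ => norm_nonneg _) (fun j _ =>
        (show ‖y 0 - t j‖ ≤ 2 * R from ?_))).trans (by simp)
      have := norm_sub_le (y 0) (t j)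
      have := htR j
      linarith
    have hFy : F y = G (Fin.tail y) (y 0) := by simp [G, Fin.cons_self_tail]
    rw [hFy, newton_interpolation t (G (Fin.tail y)) N (y 0)]
    simp only [map_sum, map_mul, map_prod, map_sub, MvPolynomial.eval_X, MvPolynomial.eval_C,
      MvPolynomial.eval_rename]
    rw [add_sub_right_comm, ← Finset.sum_sub_distrib]
    have h1 : ‖∑ k ∈ Finset.range N, (newtonRem t (G (Fin.tail y)) k (t k) *
        ∏ j ∈ Finset.range k, (y 0 - t j) - MvPolynomial.eval (y ∘ Fin.succ) (p k) *
        ∏ j ∈ Finset.range k, (y 0 - t j))‖ ≤ ε / (2 * (S + 1)) * S := by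
      rw [hS, Finset.mul_sum]
      refine (norm_sum_le _ _).trans (Finset.sum_le_sum fun k _ => ?_)
      rw [← sub_mul, norm_mul]
      exact mul_le_mul (hp k (Fin.tail y) hyt).le (hprod k) (norm_nonneg _) hε'.le
    have h2 : ‖newtonRem t (G (Fin.tail y)) N (y 0) * ∏ j ∈ Finset.range N, (y 0 - t j)‖
        ≤ M * (1 / 2) ^ N := by
      rw [norm_mul]
      have := norm_newtonRem_le t (hG2 (Fin.tail y)) (by linarith) htR (hM' _ hyt) N (y 0)
        (by linarith)
      refine (mul_le_mul this (hprod N) (norm_nonneg _) (by positivity)).trans (le_of_eq ?_)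
      rw [show 4 * R = 2 * (2 * R) by ring, mul_pow 2 (2 * R), one_div, inv_pow]
      field_simp
    have h3 : ε / (2 * (S + 1)) * S < ε / 2 := by
      rw [div_mul_eq_mul_div, div_lt_div_iff₀ (by positivity) (by positivity)]
      nlinarith
    have h4 : M * (1 / 2) ^ N ≤ ε / 2 := by
      have : M * (1 / 2) ^ N ≤ M * (ε / (2 * (M + 1))) := mul_le_mul_of_nonneg_left hN.le hM0
      refine this.trans ?_
      rw [mul_div_assoc', div_le_div_iff₀ (by positivity) (by positivity)]
      nlinarith
    refine (norm_add_le _ _).trans_lt ?_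
    linarith

end Entire

/-! ### Primitive elements of finite extensions of domains -/

section Primitive

open Polynomial

/-- A primitive element of the extension of fraction fields is rescaled into `R`; clearing
denominators in the expression of `z` as a polynomial in it gives `a`. -/
theorem exists_primitive_integral_element (A R : Type*) [CommRing A] [IsDomain A] [CharZero A]
    [CommRing R] [IsDomain R] [Algebra A R] [FaithfulSMul A R] [Module.Finite A R] :
    ∃ θ : R, ∀ z : R, ∃ a : A, a ≠ 0 ∧ ∃ p : A[X], a • z = aeval θ p := by
  let K := FractionRing A
  let L := FractionRing R
  let _ : Algebra K L := FractionRing.liftAlgebra A L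
  have hfd : FiniteDimensional K L := inferInstance
  have : CharZero K := charZero_of_injective_algebraMap (IsFractionRing.injective A K)
  have halg : Algebra.IsAlgebraic A R := inferInstance
  obtain ⟨α, hα⟩ := Field.exists_primitive_element K L
  obtain ⟨r, s, hs, rfl⟩ := IsFractionRing.div_surjective (A := R) α
  -- Since `s * s'` is the image of `a`, the element `r * s'` of `R` is `a` times `r / s` and
  -- generates the same field.
  obtain ⟨a, ha, s', hs'⟩ := (halg.1 s).exists_nonzero_dvd hs
  have hs0 : algebraMap R L s ≠ 0 := by
    simpa using nonZeroDivisors.ne_zero hs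
  have haR : algebraMap A R a ≠ 0 := by simpa using ha
  have haK : algebraMap A K a ≠ 0 := by simpa using ha
  refine ⟨r * s', fun z => ?_⟩
  have htop : IntermediateField.adjoin K {algebraMap R L (r * s')} = ⊤ := by
    rw [eq_top_iff, ← hα, IntermediateField.adjoin_simple_le_iff]
    have h : algebraMap R L r / algebraMap R L s =
        (algebraMap A K a)⁻¹ • algebraMap R L (r * s') := by
      rw [eq_inv_smul_iff₀ haK, algebraMap_smul, Algebra.smul_def,
        IsScalarTower.algebraMap_apply A R L, hs', map_mul, map_mul]
      rw [mul_div_assoc', div_eq_iff hs0]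
      ring
    rw [h]
    exact IntermediateField.smul_mem _ (IntermediateField.mem_adjoin_simple_self K _)
  have hz : algebraMap R L z ∈ (IntermediateField.adjoin K {algebraMap R L (r * s')}).toSubalgebra := by
    rw [htop]
    trivial
  rw [IntermediateField.adjoin_simple_toSubalgebra_of_isAlgebraic
    (Algebra.IsAlgebraic.isAlgebraic _), Algebra.adjoin_singleton_eq_range_aeval] at hz
  obtain ⟨p, hp⟩ := hz
  obtain ⟨b, hb, hbp⟩ := IsLocalization.integerNormalization_spec (nonZeroDivisors A) p
  refine ⟨b, nonZeroDivisors.ne_zero hb, IsLocalization.integerNormalization (nonZeroDivisors A) p, ?_⟩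
  apply IsFractionRing.injective R L
  rw [← aeval_algebraMap_apply, ← aeval_map_algebraMap K, hbp,
    ← algebraMap_smul K b p, map_smul (aeval (algebraMap R L (r * s')))]
  change aeval _ p = _ at hp
  rw [hp, algebraMap_smul]
  simp only [Algebra.smul_def, map_mul, ← IsScalarTower.algebraMap_apply]

/-- `m` is the minimal polynomial of `θ`; integral closedness makes divisibility by it detect
relations over `A` itself. The last identity lets `G` play the role of a discriminant: where `G`
does not vanish, the roots of `m` are simple and the `x c` are rational functions of `θ`. -/
theorem exists_primitive_element_data (A : Type*) {R : Type*} [CommRing A] [IsDomain A]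
    [IsIntegrallyClosed A] [CharZero A] [CommRing R] [IsDomain R] [Algebra A R] [FaithfulSMul A R]
    [Module.Finite A R] {ι : Type*} [Fintype ι] (x : ι → R) :
    ∃ (θ : R) (m v : A[X]) (q : ι → A[X]) (G : A), G ≠ 0 ∧ m.Monic ∧
      (∀ p, aeval θ p = 0 ↔ m ∣ p) ∧ (∀ c, G • x c = aeval θ (q c)) ∧
      aeval θ (v * derivative m) = algebraMap A R G := by
  classical
  obtain ⟨θ, hθ⟩ := exists_primitive_integral_element A R
  have hint : IsIntegral A θ := Algebra.IsIntegral.isIntegral θ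
  have hm := minpoly.monic hint
  have hdvd := fun p => minpoly.isIntegrallyClosed_dvd_iff hint p
  set m := minpoly A θ with hmdef
  have hm' : aeval θ (derivative m) ≠ 0 := by
    intro h
    rw [hdvd] at h
    have h0 : derivative m = 0 := by
      by_contra hne
      have h1 := natDegree_le_of_dvd h hne
      have h2 : m.natDegree ≠ 0 := (minpoly.natDegree_pos hint).ne'
      have h3 := natDegree_derivative_lt h2
      omega
    exact (minpoly.natDegree_pos hint).ne' (derivative_eq_zero.1 h0)
  obtain ⟨g, hg, z, hz⟩ := ((inferInstance : Algebra.IsAlgebraic A R).1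
    (aeval θ (derivative m))).exists_nonzero_dvd (mem_nonZeroDivisors_of_ne_zero hm')
  obtain ⟨a, ha, p, hp⟩ := hθ z
  choose b hb r hr using fun c => hθ (x c)
  refine ⟨θ, m, C (∏ c, b c) * p, fun c => C (a * g * ∏ c' ∈ Finset.univ.erase c, b c') * r c,
    a * g * ∏ c, b c, mul_ne_zero (mul_ne_zero ha hg) (Finset.prod_ne_zero_iff.2 fun c _ => hb c),
    hm, hdvd, fun c => ?_, ?_⟩
  · rw [map_mul, aeval_C, ← hr, ← Finset.mul_prod_erase _ _ (Finset.mem_univ c)]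
    simp only [Algebra.smul_def, map_mul]
    ring
  · rw [map_mul, map_mul, aeval_C, ← hp, map_mul, map_mul, hz, Algebra.smul_def]
    ring

end Primitive

/-! ### Points of a finite extension of a polynomial ring -/

section Points

open Polynomial

/-- The value of a polynomial `p ∈ ℂ[y][T]` at `y` and `T = t`. -/
noncomputable def evalPair {σ : Type*} (y : σ → ℂ) (t : ℂ) : (MvPolynomial σ ℂ)[X] →+* ℂ :=
  eval₂RingHom (MvPolynomial.eval y) t

@[simp]
theorem evalPair_C {σ : Type*} (y : σ → ℂ) (t : ℂ) (a : MvPolynomial σ ℂ) :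
    evalPair y t (C a) = MvPolynomial.eval y a := by
  simp [evalPair]

@[simp]
theorem evalPair_X {σ : Type*} (y : σ → ℂ) (t : ℂ) : evalPair y t X = t := by
  simp [evalPair]

theorem evalPair_eq {σ : Type*} (y : σ → ℂ) (t : ℂ) (p : (MvPolynomial σ ℂ)[X]) :
    evalPair y t p = (p.map (MvPolynomial.eval y)).eval t := by
  simp [evalPair, eval_map]

theorem exists_algHom_comp_eq {k S R T : Type*} [CommRing k] [CommRing S] [CommRing R] [CommRing T]
    [Algebra k S] [Algebra k R] [Algebra k T] {mk : S →ₐ[k] R} (hmk : Function.Surjective mk)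
    {f : S →ₐ[k] T} (hle : RingHom.ker mk ≤ RingHom.ker f) :
    ∃ φ : R →ₐ[k] T, ∀ Q, φ (mk Q) = f Q := by
  refine ⟨(Ideal.Quotient.liftₐ _ f hle).comp
    (Ideal.quotientKerAlgEquivOfSurjective hmk).symm.toAlgHom, fun Q => ?_⟩
  have : (Ideal.quotientKerAlgEquivOfSurjective hmk).symm (mk Q) = Ideal.Quotient.mk _ Q := by
    rw [AlgEquiv.symm_apply_eq]
    rfl
  change (Ideal.Quotient.liftₐ _ f hle) ((Ideal.quotientKerAlgEquivOfSurjective hmk).symm (mk Q)) = _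
  rw [this]
  rfl

/-- Away from the zeros of `G`, a root `t` of `m(y, T)` determines a point of the cover with `θ =
t`: its coordinates must be `q c (y, t) / G(y)`. -/
theorem exists_algHom_of_evalPair_eq_zero {σ ι R : Type*} [CommRing R] [Algebra ℂ R]
    [Algebra (MvPolynomial σ ℂ) R] [IsScalarTower ℂ (MvPolynomial σ ℂ) R] {x : ι → R}
    (hx : Function.Surjective (MvPolynomial.aeval x : MvPolynomial ι ℂ →ₐ[ℂ] R)) {θ : R}
    {m : (MvPolynomial σ ℂ)[X]} {q : ι → (MvPolynomial σ ℂ)[X]} {G : MvPolynomial σ ℂ}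
    (hm : ∀ p, aeval θ p = 0 ↔ m ∣ p) (hq : ∀ c, G • x c = aeval θ (q c)) {y : σ → ℂ} {t : ℂ}
    (hG : MvPolynomial.eval y G ≠ 0) (ht : evalPair y t m = 0) :
    ∃ φ : R →ₐ[ℂ] ℂ, ∀ p, φ (aeval θ p) = evalPair y t p := by
  set ξ : ι → ℂ := fun c => evalPair y t (q c) / MvPolynomial.eval y G with hξ
  -- Up to a power of `G`, every polynomial in the `x c` is a polynomial in `θ`, compatibly with
  -- evaluation at `ξ`. A relation among the `x c` thus becomes a multiple of `m`, which vanishes at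
  -- `(y, t)`; after division by the power of `G(y)`, the relation holds at `ξ`.
  have key : ∀ Q : MvPolynomial ι ℂ, ∃ (N : ℕ) (p : (MvPolynomial σ ℂ)[X]),
      aeval θ p = G ^ N • MvPolynomial.aeval x Q ∧
      evalPair y t p = MvPolynomial.eval y G ^ N * MvPolynomial.aeval ξ Q := by
    intro Q
    induction Q using MvPolynomial.induction_on with
    | C a =>
      refine ⟨0, C (MvPolynomial.C a), ?_, by simp⟩
      simp only [aeval_C, pow_zero, one_smul, MvPolynomial.algHom_C]
      exact (IsScalarTower.algebraMap_apply ℂ (MvPolynomial σ ℂ) R a).symm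
    | add Q Q' h h' =>
      obtain ⟨N, p, h1, h2⟩ := h
      obtain ⟨N', p', h1', h2'⟩ := h'
      refine ⟨N + N', C (G ^ N') * p + C (G ^ N) * p', ?_, ?_⟩
      · simp only [map_add, map_mul, h1, h1', aeval_C, Algebra.smul_def, map_pow]
        ring
      · simp only [map_add, map_mul, h2, h2', evalPair_C, map_pow]
        ring
    | mul_X Q c h =>
      obtain ⟨N, p, h1, h2⟩ := h
      refine ⟨N + 1, p * q c, ?_, ?_⟩
      · simp only [map_mul, h1, ← hq, Algebra.smul_def, map_pow, MvPolynomial.aeval_X]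
        ring
      · simp only [map_mul, h2, MvPolynomial.aeval_X, hξ]
        field_simp
        ring
  have hker : ∀ p, aeval θ p = 0 → evalPair y t p = 0 := by
    intro p hp
    obtain ⟨r, rfl⟩ := (hm p).1 hp
    rw [map_mul, ht, zero_mul]
  have hle : RingHom.ker (MvPolynomial.aeval x : MvPolynomial ι ℂ →ₐ[ℂ] R) ≤
      RingHom.ker (MvPolynomial.aeval ξ : MvPolynomial ι ℂ →ₐ[ℂ] ℂ) := by
    intro Q hQ
    rw [RingHom.mem_ker] at hQ ⊢
    obtain ⟨N, p, h1, h2⟩ := key Q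
    rw [hQ, smul_zero] at h1
    rw [hker p h1] at h2
    exact (mul_eq_zero.1 h2.symm).resolve_left (pow_ne_zero _ hG)
  obtain ⟨φ, hφ⟩ := exists_algHom_comp_eq hx hle
  refine ⟨φ, fun p => ?_⟩
  obtain ⟨Q, hQ⟩ := hx (aeval θ p)
  obtain ⟨N, p', h1, h2⟩ := key Q
  rw [← hQ, hφ]
  have h3 := hker (p' - C (G ^ N) * p) (by
    rw [map_sub, h1, hQ, map_mul, aeval_C, Algebra.smul_def, sub_self])
  rw [map_sub, h2, map_mul, evalPair_C, map_pow, ← mul_sub] at h3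
  exact sub_eq_zero.1 ((mul_eq_zero.1 h3).resolve_left (pow_ne_zero _ hG))

end Points

/-! ### Weighted power sums over the roots of a monic polynomial with polynomial coefficients -/

section PowerSums

open Polynomial

variable {s : ℕ}

theorem analyticAt_evalPair (p : (MvPolynomial (Fin s) ℂ)[X]) (u : (Fin s → ℂ) × ℂ) :
    AnalyticAt ℂ (fun u : (Fin s → ℂ) × ℂ => evalPair u.1 u.2 p) u := by
  induction p using Polynomial.induction_on' with
  | add p q hp hq => simpa using hp.fun_add hq
  | monomial n a =>
    simp only [← C_mul_X_pow_eq_monomial, map_mul, map_pow, evalPair_C, evalPair_X]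
    have h : AnalyticAt ℂ (fun u : (Fin s → ℂ) × ℂ => MvPolynomial.eval u.1 a) u := by
      refine AnalyticAt.aeval_mvPolynomial (f := fun u : (Fin s → ℂ) × ℂ => u.1) (fun i => ?_) a
      exact ((ContinuousLinearMap.proj (R := ℂ) (φ := fun _ : Fin s => ℂ) i).comp
        (ContinuousLinearMap.fst ℂ (Fin s → ℂ) ℂ)).analyticAt u
    exact h.mul (analyticAt_snd.pow n)

theorem fderiv_evalPair_inr (p : (MvPolynomial (Fin s) ℂ)[X]) (u : (Fin s → ℂ) × ℂ) (r : ℂ) :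
    fderiv ℂ (fun u : (Fin s → ℂ) × ℂ => evalPair u.1 u.2 p) u (0, r) =
      r * evalPair u.1 u.2 (derivative p) := by
  have h1 := (analyticAt_evalPair p u).differentiableAt.hasFDerivAt.comp_hasDerivAt_of_eq u.2
    ((hasDerivAt_const u.2 u.1).prodMk (hasDerivAt_id u.2)) rfl
  have h2 := (p.map (MvPolynomial.eval u.1)).hasDerivAt u.2
  have h3 : (fun t => (p.map (MvPolynomial.eval u.1)).eval t) =
      (fun u : (Fin s → ℂ) × ℂ => evalPair u.1 u.2 p) ∘ fun t => (u.1, t) := by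
    funext t
    simp [evalPair_eq]
  rw [h3] at h2
  have h4 := h1.unique h2
  rw [derivative_map, ← evalPair_eq] at h4
  rw [← h4, ← smul_eq_mul, ← map_smul]
  simp

theorem exists_root_section {m : (MvPolynomial (Fin s) ℂ)[X]} {y : Fin s → ℂ} {t : ℂ}
    (h0 : evalPair y t m = 0) (h1 : evalPair y t (derivative m) ≠ 0) :
    ∃ τ : (Fin s → ℂ) → ℂ, DifferentiableAt ℂ τ y ∧ τ y = t ∧
      ∀ᶠ z in 𝓝 y, evalPair z (τ z) m = 0 := by
  have hs := (analyticAt_evalPair m (y, t)).hasStrictFDerivAt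
  have hinv : (fderiv ℂ (fun u : (Fin s → ℂ) × ℂ => evalPair u.1 u.2 m) (y, t) ∘L
      .inr ℂ (Fin s → ℂ) ℂ).IsInvertible := by
    refine ⟨ContinuousLinearEquiv.smulLeft (Units.mk0 _ h1), ?_⟩
    ext
    simp [fderiv_evalPair_inr, Units.smul_def]
  have hτ := hs.hasStrictFDerivAt_implicitFunctionOfProdDomain hinv
  refine ⟨_, hτ.hasFDerivAt.differentiableAt,
    ((hs.eventually_apply_eq_iff_implicitFunctionOfProdDomain hinv).self_of_nhds.mp rfl), ?_⟩
  filter_upwards [hs.eventually_apply_implicitFunctionOfProdDomain hinv] with z hz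
  exact hz.trans h0

/-- The set of roots of `m(y, T)`. -/
noncomputable def rootsAt (m : (MvPolynomial (Fin s) ℂ)[X]) (y : Fin s → ℂ) : Finset ℂ :=
  (m.map (MvPolynomial.eval y)).roots.toFinset

theorem mem_rootsAt {m : (MvPolynomial (Fin s) ℂ)[X]} (hm : m.Monic) {y : Fin s → ℂ} {t : ℂ} :
    t ∈ rootsAt m y ↔ evalPair y t m = 0 := by
  simp [rootsAt, evalPair_eq, (hm.map _).ne_zero]

theorem card_rootsAt_le {m : (MvPolynomial (Fin s) ℂ)[X]} (hm : m.Monic) (y : Fin s → ℂ) :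
    (rootsAt m y).card ≤ m.natDegree := by
  refine (Multiset.toFinset_card_le _).trans ((card_roots' _).trans ?_)
  rw [hm.natDegree_map]

theorem card_rootsAt {m : (MvPolynomial (Fin s) ℂ)[X]} (hm : m.Monic) {y : Fin s → ℂ}
    (h : ∀ t, evalPair y t m = 0 → evalPair y t (derivative m) ≠ 0) :
    (rootsAt m y).card = m.natDegree := by
  have hnd : (m.map (MvPolynomial.eval y)).roots.Nodup := by
    rw [Multiset.nodup_iff_count_le_one]
    intro t
    rw [count_roots]
    by_contra! hlt
    have := (one_lt_rootMultiplicity_iff_isRoot (hm.map _).ne_zero).1 hlt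
    refine h t ?_ ?_
    · rw [evalPair_eq]; exact this.1
    · rw [evalPair_eq, ← derivative_map]; exact this.2
  rw [rootsAt, Multiset.toFinset_card_of_nodup hnd, IsAlgClosed.card_roots_eq_natDegree,
    hm.natDegree_map]

/-- Cauchy's bound for a monic polynomial depends only on its coefficients, which are bounded on the
ball. This gives boundedness of fibres over bounded sets. -/
theorem exists_bound_of_evalPair_eq_zero {m : (MvPolynomial (Fin s) ℂ)[X]} (hm : m.Monic) (R : ℝ) :
    ∃ B : ℝ, ∀ y : Fin s → ℂ, ‖y‖ ≤ R → ∀ t, evalPair y t m = 0 → ‖t‖ ≤ B := by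
  have hb : ∀ k, ∃ M : ℝ, ∀ y ∈ Metric.closedBall (0 : Fin s → ℂ) R,
      ‖MvPolynomial.eval y (m.coeff k)‖ ≤ M := fun k =>
    (isCompact_closedBall _ _).exists_bound_of_continuousOn
      (MvPolynomial.continuous_eval _).continuousOn
  choose M hM using hb
  refine ⟨(∑ k ∈ Finset.range m.natDegree, (M k).toNNReal : NNReal) + 1, fun y hy t ht => ?_⟩
  rw [evalPair_eq] at ht
  have h1 := (IsRoot.norm_lt_cauchyBound (hm.map (MvPolynomial.eval y)).ne_zero ht).le
  have h2 : cauchyBound (m.map (MvPolynomial.eval y)) ≤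
      ∑ k ∈ Finset.range m.natDegree, (M k).toNNReal + 1 := by
    rw [cauchyBound, (hm.map _).leadingCoeff, nnnorm_one, div_one, hm.natDegree_map]
    refine add_le_add_left (Finset.sup_le fun k hk => ?_) _
    refine le_trans ?_ (Finset.single_le_sum (f := fun k => (M k).toNNReal) (fun _ _ => zero_le) hk)
    rw [coeff_map]
    refine NNReal.le_toNNReal_of_coe_le ?_
    exact hM k y (by simpa using hy)
  exact_mod_cast h1.trans h2

/-- The local sections through the roots at `y` stay distinct nearby. There are already `natDegree`
of them, so they exhaust the roots at `z`. -/
theorem eventually_sum_rootsAt_eq {m : (MvPolynomial (Fin s) ℂ)[X]} (hm : m.Monic) {y : Fin s → ℂ}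
    (h : ∀ t, evalPair y t m = 0 → evalPair y t (derivative m) ≠ 0) {τ : ℂ → (Fin s → ℂ) → ℂ}
    (hτ : ∀ t ∈ rootsAt m y, ContinuousAt (τ t) y ∧ τ t y = t ∧
      ∀ᶠ z in 𝓝 y, evalPair z (τ t z) m = 0) (g : (Fin s → ℂ) → ℂ → ℂ) :
    ∀ᶠ z in 𝓝 y, ∑ t ∈ rootsAt m z, g z t = ∑ t ∈ rootsAt m y, g z (τ t z) := by
  classical
  have h1 : ∀ᶠ z in 𝓝 y, ∀ t ∈ rootsAt m y, evalPair z (τ t z) m = 0 :=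
    (Filter.eventually_all_finset _).2 fun t ht => (hτ t ht).2.2
  have h2 : ∀ᶠ z in 𝓝 y, ∀ t ∈ rootsAt m y, ∀ t' ∈ rootsAt m y, t ≠ t' → τ t z ≠ τ t' z := by
    refine (Filter.eventually_all_finset _).2 fun t ht => (Filter.eventually_all_finset _).2
      fun t' ht' => ?_
    by_cases hne : t = t'
    · simp [hne]
    · refine (((hτ t ht).1.ne_iff_eventually_ne (hτ t' ht').1).1 ?_).mono fun z hz _ => hz
      rwa [(hτ t ht).2.1, (hτ t' ht').2.1]
  filter_upwards [h1, h2] with z hz1 hz2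
  have hinj : Set.InjOn (fun t => τ t z) (rootsAt m y : Set ℂ) := fun t ht t' ht' he =>
    by_contra fun hne => hz2 t ht t' ht' hne he
  have himg : (rootsAt m y).image (fun t => τ t z) = rootsAt m z := by
    refine Finset.eq_of_subset_of_card_le ?_ ?_
    · intro t ht
      obtain ⟨t', ht', rfl⟩ := Finset.mem_image.1 ht
      exact (mem_rootsAt hm).2 (hz1 t' ht')
    · rw [Finset.card_image_of_injOn hinj, card_rootsAt hm h]
      exact card_rootsAt_le hm z
  rw [← himg, Finset.sum_image hinj]

end PowerSums

/-! ### Traces along the branched cover are entire. -/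

section WeightedPowerSums

open Polynomial

variable {ι : Type} [Fintype ι] {s : ℕ}

theorem differentiableAt_extend_comp {E : Type*} [NormedAddCommGroup E] [NormedSpace ℂ E]
    {X : Set (ι → ℂ)} (f : HoloFun X) {g : E → ι → ℂ} {y : E} (hg : DifferentiableAt ℂ g y)
    (hgX : ∀ᶠ z in 𝓝 y, g z ∈ X) :
    DifferentiableAt ℂ (fun z => Function.extend Subtype.val (f : C(X, ℂ)) 0 (g z)) y := by
  obtain ⟨F, hF, hfF⟩ := f.2 ⟨g y, hgX.self_of_nhds⟩
  rw [nhds_subtype_eq_comap, Filter.eventually_comap] at hfF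
  refine (hF.differentiableAt.comp y hg).congr_of_eventuallyEq ?_
  filter_upwards [hgX, hg.continuousAt.eventually hfF] with z hz1 hz2
  have := hz2 ⟨g z, hz1⟩ rfl
  rw [Function.comp_apply, ← this]
  exact Subtype.val_injective.extend_apply (f : C(X, ℂ)) 0 ⟨g z, hz1⟩

/-- This handles the branch locus: a bounded function times `G²` is differentiable at each zero of
`G`, with derivative zero. The square is what makes any extension theorem across `{G = 0}`
unnecessary. -/
theorem hasFDerivAt_zero_of_norm_le_sq {E : Type*} [NormedAddCommGroup E] [NormedSpace ℂ E]
    {H g : E → ℂ} {y : E} {C : ℝ} (hg : DifferentiableAt ℂ g y) (hgy : g y = 0)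
    (hH : ∀ᶠ z in 𝓝 y, ‖H z‖ ≤ C * ‖g z ^ 2‖) : HasFDerivAt H (0 : E →L[ℂ] ℂ) y := by
  have hHy : H y = 0 := by
    have := hH.self_of_nhds
    simpa [hgy] using this
  refine .of_isLittleO ?_
  have h1 : H =O[𝓝 y] fun z => g z ^ 2 := Asymptotics.IsBigO.of_bound C hH
  have h2 : g =O[𝓝 y] fun z => z - y := by simpa [hgy] using hg.isBigO_sub
  have h3 : g =o[𝓝 y] fun _ => (1 : ℝ) := by
    rw [Asymptotics.isLittleO_one_iff]
    simpa [hgy] using hg.continuousAt.tendsto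
  have h4 : (fun z => g z ^ 2) =o[𝓝 y] fun z => ‖z - y‖ := by
    simpa [sq] using h3.mul_isBigO h2.norm_right
  simpa [hHy] using (h1.trans_isLittleO h4).norm_right.of_norm_right

theorem differentiable_weightedPowerSum {X : Set (ι → ℂ)} (hX : IsClosed X) (f : HoloFun X)
    {m : (MvPolynomial (Fin s) ℂ)[X]} (hm : m.Monic) {G : MvPolynomial (Fin s) ℂ}
    {ξ : (Fin s → ℂ) → ℂ → ι → ℂ}
    (hsep : ∀ y t, MvPolynomial.eval y G ≠ 0 → evalPair y t m = 0 →
      evalPair y t (derivative m) ≠ 0)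
    (hξd : ∀ y t, MvPolynomial.eval y G ≠ 0 →
      DifferentiableAt ℂ (fun u : (Fin s → ℂ) × ℂ => ξ u.1 u.2) (y, t))
    (hξX : ∀ y t, MvPolynomial.eval y G ≠ 0 → evalPair y t m = 0 → ξ y t ∈ X)
    (hξb : ∀ R : ℝ, ∃ B : ℝ, ∀ y, ‖y‖ ≤ R → ∀ t, MvPolynomial.eval y G ≠ 0 →
      evalPair y t m = 0 → ‖ξ y t‖ ≤ B) (l : ℕ) :
    Differentiable ℂ fun y => MvPolynomial.eval y G ^ 2 *
      ∑ t ∈ rootsAt m y, Function.extend Subtype.val (f : C(X, ℂ)) 0 (ξ y t) * t ^ l := by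
  have hGd : Differentiable ℂ fun y => MvPolynomial.eval y G := fun y =>
    (AnalyticOnNhd.eval_mvPolynomial G y trivial).differentiableAt
  intro y
  -- At a zero of `G` the fibre sum itself may have no meaning, but only its boundedness nearby
  -- matters: `X` is closed, so `f` is bounded on the bounded set containing the nearby fibre
  -- points. Elsewhere the sum is a finite sum over local sections of the roots.
  by_cases hy : MvPolynomial.eval y G = 0
  · obtain ⟨B, hB⟩ := hξb (‖y‖ + 1)
    obtain ⟨B', hB'⟩ := exists_bound_of_evalPair_eq_zero hm (‖y‖ + 1)
    have hK : IsCompact ((Subtype.val : X → ι → ℂ) ⁻¹' Metric.closedBall 0 B) :=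
      hX.isClosedEmbedding_subtypeVal.isCompact_preimage (isCompact_closedBall _ _)
    obtain ⟨D, hD⟩ := hK.exists_bound_of_continuousOn (f : C(X, ℂ)).continuous.continuousOn
    have hterm : ∀ z, ‖z‖ ≤ ‖y‖ + 1 → MvPolynomial.eval z G ≠ 0 →
        ‖∑ t ∈ rootsAt m z, Function.extend Subtype.val (f : C(X, ℂ)) 0 (ξ z t) * t ^ l‖ ≤
          m.natDegree * (max D 0 * max B' 0 ^ l) := by
      intro z hz hGz
      have hle : ∀ t ∈ rootsAt m z,
          ‖Function.extend Subtype.val (f : C(X, ℂ)) 0 (ξ z t) * t ^ l‖ ≤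
            max D 0 * max B' 0 ^ l := by
        intro t ht
        rw [mem_rootsAt hm] at ht
        rw [norm_mul, norm_pow]
        refine mul_le_mul ?_ (pow_le_pow_left₀ (norm_nonneg _)
          ((hB' z hz t ht).trans (le_max_left _ _)) l) (by positivity) (le_max_right _ _)
        have := hD ⟨ξ z t, hξX z t hGz ht⟩ (by simpa using hB z hz t hGz ht)
        refine le_trans (le_of_eq ?_) (this.trans (le_max_left _ _))
        exact congrArg _ (Subtype.val_injective.extend_apply (f : C(X, ℂ)) 0 ⟨ξ z t, _⟩)
      refine (norm_sum_le _ _).trans ((Finset.sum_le_card_nsmul _ _ _ hle).trans ?_)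
      rw [nsmul_eq_mul]
      refine mul_le_mul_of_nonneg_right ?_ (by positivity)
      exact_mod_cast card_rootsAt_le hm z
    refine (hasFDerivAt_zero_of_norm_le_sq (C := m.natDegree * (max D 0 * max B' 0 ^ l))
      (hGd y) hy ?_).differentiableAt
    filter_upwards [Metric.closedBall_mem_nhds y one_pos] with z hz
    by_cases hGz : MvPolynomial.eval z G = 0
    · simp [hGz]
    rw [norm_mul, mul_comm]
    refine mul_le_mul_of_nonneg_right (hterm z ?_ hGz) (norm_nonneg _)
    rw [mem_closedBall_iff_norm] at hz
    have := norm_le_norm_add_norm_sub' z y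
    linarith
  · have hnear : ∀ᶠ z in 𝓝 y, MvPolynomial.eval z G ≠ 0 :=
      (hGd y).continuousAt.eventually_ne hy
    have hτ : ∀ t, ∃ τ : (Fin s → ℂ) → ℂ, evalPair y t m = 0 → DifferentiableAt ℂ τ y ∧ τ y = t ∧
        ∀ᶠ z in 𝓝 y, evalPair z (τ z) m = 0 := by
      intro t
      by_cases ht : evalPair y t m = 0
      · obtain ⟨τ, h⟩ := exists_root_section ht (hsep y t hy ht)
        exact ⟨τ, fun _ => h⟩
      · exact ⟨0, fun h => absurd h ht⟩
    choose τ hτ using hτ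
    have heq := eventually_sum_rootsAt_eq hm (fun t => hsep y t hy) (τ := τ)
      (fun t ht => ⟨(hτ t ((mem_rootsAt hm).1 ht)).1.continuousAt,
        (hτ t ((mem_rootsAt hm).1 ht)).2⟩)
      (fun z t => Function.extend Subtype.val (f : C(X, ℂ)) 0 (ξ z t) * t ^ l)
    refine ((hGd y).pow 2).mul (DifferentiableAt.congr_of_eventuallyEq ?_ heq)
    refine DifferentiableAt.fun_sum fun t ht => ?_
    obtain ⟨h1, h2, h3⟩ := hτ t ((mem_rootsAt hm).1 ht)
    refine DifferentiableAt.mul (differentiableAt_extend_comp f (g := fun z => ξ z (τ t z)) ?_ ?_)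
      (h1.pow l)
    · have h4 := hξd y (τ t y) hy
      exact DifferentiableAt.comp (f := fun z => (z, τ t z)) y h4 (differentiableAt_id.prodMk h1)
    · filter_upwards [h3, hnear] with z hz1 hz2 using hξX z _ hz2 hz1

end WeightedPowerSums

/-! ### Polynomial functions on an affine algebraic set -/

section PolynomialFunctions

variable {ι : Type} [Fintype ι]

/-- The coordinate functions on `X`. -/
def coordFun (X : Set (ι → ℂ)) (c : ι) : HoloFun X :=
  ⟨⟨fun x => (x : ι → ℂ) c, (continuous_apply c).comp continuous_subtype_val⟩,
    fun _ => ⟨fun y => y c, (ContinuousLinearMap.proj (R := ℂ) (φ := fun _ : ι => ℂ) c).analyticAt _,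
      Filter.Eventually.of_forall fun _ => rfl⟩⟩

/-- The restriction of polynomials to `X`. -/
noncomputable def polyFun (X : Set (ι → ℂ)) : MvPolynomial ι ℂ →ₐ[ℂ] HoloFun X :=
  MvPolynomial.aeval (coordFun X)

/-- Evaluation at a point of `X`. -/
noncomputable def evalAt {X : Set (ι → ℂ)} (x : X) : C(X, ℂ) →ₐ[ℂ] ℂ := ContinuousMap.evalAlgHom ℂ ℂ x

theorem polyFun_apply {X : Set (ι → ℂ)} (p : MvPolynomial ι ℂ) (x : X) :
    (polyFun X p : C(X, ℂ)) x = MvPolynomial.eval (x : ι → ℂ) p := by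
  change ((evalAt x).comp ((HoloFun X).val.comp (polyFun X))) p = MvPolynomial.aeval (x : ι → ℂ) p
  congr 1
  ext c
  simp only [AlgHom.comp_apply, polyFun, MvPolynomial.aeval_X]
  rfl

/-- The closure of the polynomials in the compact-open topology. -/
noncomputable def polyClosure (X : Set (ι → ℂ)) [LocallyCompactSpace X] : Subalgebra ℂ C(X, ℂ) :=
  ((HoloFun X).val.comp (polyFun X)).range.topologicalClosure

theorem polyFun_mem_polyClosure (X : Set (ι → ℂ)) [LocallyCompactSpace X] (p : MvPolynomial ι ℂ) :
    (polyFun X p : C(X, ℂ)) ∈ polyClosure X :=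
  Subalgebra.le_topologicalClosure _ ⟨p, rfl⟩

/-- Approximate `F` to within `1/(n+1)` on the ball of radius `n+1`; the polynomials `Y` map each
compact set into one of these balls. -/
theorem entire_comp_mem_polyClosure {X : Set (ι → ℂ)} [LocallyCompactSpace X] {s : ℕ} {F : (Fin s → ℂ) → ℂ}
    (hF : Differentiable ℂ F) (Y : Fin s → MvPolynomial ι ℂ) {g : C(X, ℂ)}
    (hg : ∀ x : X, g x = F fun i => MvPolynomial.eval (x : ι → ℂ) (Y i)) : g ∈ polyClosure X := by
  have hp : ∀ n : ℕ, ∃ p : MvPolynomial (Fin s) ℂ, ∀ y, ‖y‖ ≤ (n : ℝ) + 1 →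
      ‖F y - MvPolynomial.eval y p‖ < 1 / ((n : ℝ) + 1) := fun n =>
    exists_mvPolynomial_near_of_differentiable hF (by simp) (by positivity)
  choose p hp using hp
  have hYc : Continuous fun x : X => fun i => MvPolynomial.eval (x : ι → ℂ) (Y i) :=
    continuous_pi fun i => (MvPolynomial.continuous_eval (Y i)).comp continuous_subtype_val
  refine mem_closure_of_tendsto (f := fun n => (polyFun X (MvPolynomial.aeval Y (p n)) : C(X, ℂ)))
    (b := Filter.atTop) ?_ (Filter.Eventually.of_forall fun n => ⟨_, rfl⟩)
  rw [ContinuousMap.tendsto_iff_forall_isCompact_tendstoUniformlyOn]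
  intro K hK
  obtain ⟨M, hM⟩ := hK.exists_bound_of_continuousOn hYc.continuousOn
  rw [Metric.tendstoUniformlyOn_iff]
  intro ε hε
  filter_upwards [tendsto_one_div_add_atTop_nhds_zero_nat.eventually_lt_const hε,
    Filter.eventually_ge_atTop ⌈M⌉₊] with n hn1 hn2 x hx
  rw [dist_eq_norm, hg, polyFun_apply]
  have h : MvPolynomial.eval (x : ι → ℂ) (MvPolynomial.aeval Y (p n)) =
      MvPolynomial.eval (fun i => MvPolynomial.eval (x : ι → ℂ) (Y i)) (p n) := by
    have := MvPolynomial.comp_aeval_apply Y (MvPolynomial.aeval (x : ι → ℂ)) (p n)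
    exact this
  rw [h]
  refine (hp n _ ((hM x hx).trans ?_)).trans hn1
  have := (Nat.le_ceil M).trans (Nat.cast_le.2 hn2)
  linarith

end PolynomialFunctions

/-! ### Recovering a holomorphic function from its traces, up to a fixed multiplier. -/

section BranchedCover

open Polynomial

/-- The double sum is `(p(t) - p(u)) / (t - u)` written as a polynomial. It serves as the Lagrange
interpolation kernel: among the roots `u` it singles out `u = t`. -/
theorem sum_coeff_mul_geom_sum₂ (p : ℂ[X]) (t u : ℂ) (ht : p.eval t = 0) (hu : p.eval u = 0) :
    ∑ k ∈ Finset.range (p.natDegree + 1), p.coeff k *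
      ∑ i ∈ Finset.range k, t ^ i * u ^ (k - 1 - i) = if u = t then (derivative p).eval t else 0 := by
  split_ifs with h
  · subst h
    rw [derivative_eval, sum_over_range _ (by simp)]
    refine Finset.sum_congr rfl fun k _ => ?_
    rw [geom_sum₂_self]
    ring
  · refine (mul_eq_zero.1 ?_).resolve_right (sub_ne_zero.2 (Ne.symm h))
    rw [Finset.sum_mul]
    simp only [mul_assoc, geom_sum₂_mul]
    simp only [mul_sub, Finset.sum_sub_distrib]
    rw [← eval_eq_sum_range, ← eval_eq_sum_range, ht, hu, sub_self]

theorem algHom_aeval_eq_evalPair {σ R : Type*} [CommRing R] [Algebra ℂ R]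
    [Algebra (MvPolynomial σ ℂ) R] {φ : R →ₐ[ℂ] ℂ} {y : σ → ℂ}
    (hφ : ∀ a, φ (algebraMap (MvPolynomial σ ℂ) R a) = MvPolynomial.eval y a) (r : R)
    (p : (MvPolynomial σ ℂ)[X]) : φ (aeval r p) = evalPair y (φ r) p := by
  induction p using Polynomial.induction_on' with
  | add p q hp hq => simp [hp, hq]
  | monomial n a => simp [← C_mul_X_pow_eq_monomial, hφ]

variable {ι : Type} [Fintype ι]

/-- With `F_l = G² ∑ f(ξ(y,u)) u^l` over the roots `u`, the interpolation kernel gives `G² m'(t) f =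
∑ m_k tⁱ F_{k-1-i}(y)`, summed over `k` and `i < k`. The right side is built from polynomials and
entire functions of polynomials, and the multiplier does not depend on `f`. -/
theorem exists_polynomial_mul_eq_polyClosure {X : Set (ι → ℂ)} [LocallyCompactSpace X] (hX : IsClosed X)
    {R : Type} [CommRing R] [IsDomain R] [Algebra ℂ R] {mk : MvPolynomial ι ℂ →ₐ[ℂ] R}
    (hmk : Function.Surjective mk) (hPX : MvPolynomial.zeroLocus ℂ (RingHom.ker mk) ⊆ X) :
    ∃ H : MvPolynomial ι ℂ, mk H ≠ 0 ∧ ∀ f : HoloFun X, ∃ Φ ∈ polyClosure X,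
      ∀ x : X, (x : ι → ℂ) ∈ MvPolynomial.zeroLocus ℂ (RingHom.ker mk) →
        MvPolynomial.eval (x : ι → ℂ) H * (f : C(X, ℂ)) x = Φ x := by
  have hft : Algebra.FiniteType ℂ R := Algebra.FiniteType.of_surjective mk hmk
  obtain ⟨s, g, hginj, hgfin⟩ := exists_finite_inj_algHom_of_fg ℂ R
  let _ : Algebra (MvPolynomial (Fin s) ℂ) R := g.toRingHom.toAlgebra
  have : IsScalarTower ℂ (MvPolynomial (Fin s) ℂ) R := IsScalarTower.of_algebraMap_eq fun r =>
    (g.commutes r).symm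
  have hfin : Module.Finite (MvPolynomial (Fin s) ℂ) R := hgfin
  have : FaithfulSMul (MvPolynomial (Fin s) ℂ) R :=
    (faithfulSMul_iff_algebraMap_injective _ _).2 hginj
  let x : ι → R := fun c => mk (MvPolynomial.X c)
  have hxmk : (MvPolynomial.aeval x : MvPolynomial ι ℂ →ₐ[ℂ] R) = mk := by
    ext c
    simp [x]
  obtain ⟨θ, m, v, q, G, hG0, hm, hdvd, hq, hv⟩ :=
    exists_primitive_element_data (MvPolynomial (Fin s) ℂ) x
  obtain ⟨Θ, hΘ⟩ := hmk θ
  choose Y hY using fun i => hmk (g (MvPolynomial.X i))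
  have hgY : ∀ a, g a = mk (MvPolynomial.aeval Y a) := by
    intro a
    change g a = (mk.comp (MvPolynomial.aeval Y)) a
    congr 1
    ext i
    simp [hY]
  have hmθ : aeval θ m = 0 := (hdvd m).2 dvd_rfl
  have hGR : algebraMap (MvPolynomial (Fin s) ℂ) R G ≠ 0 := by
    rw [Ne, FaithfulSMul.algebraMap_eq_zero_iff]
    exact hG0
  have hm'θ : aeval θ (derivative m) ≠ 0 := by
    intro h
    rw [map_mul, h, mul_zero] at hv
    exact hGR hv.symm
  obtain ⟨H, hH⟩ := hmk (algebraMap (MvPolynomial (Fin s) ℂ) R G ^ 2 * aeval θ (derivative m))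
  refine ⟨H, ?_, fun f => ?_⟩
  · rw [hH]
    exact mul_ne_zero (pow_ne_zero _ hGR) hm'θ
  -- the inverse of the branched cover
  let ξ : (Fin s → ℂ) → ℂ → ι → ℂ := fun y t c =>
    evalPair y t (q c) / MvPolynomial.eval y G
  have hsep : ∀ y t, MvPolynomial.eval y G ≠ 0 → evalPair y t m = 0 →
      evalPair y t (derivative m) ≠ 0 := by
    intro y t hy ht h
    have : aeval θ (v * derivative m - C G) = 0 := by rw [map_sub, hv, aeval_C, sub_self]
    obtain ⟨r, hr⟩ := (hdvd _).1 this
    have h2 := congrArg (evalPair y t) hr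
    rw [map_sub, map_mul, map_mul, h, ht, evalPair_C, mul_zero, zero_mul, zero_sub,
      neg_eq_zero] at h2
    exact hy h2
  have hpt : ∀ y t, MvPolynomial.eval y G ≠ 0 → evalPair y t m = 0 → ∃ φ : R →ₐ[ℂ] ℂ,
      (∀ a, φ (algebraMap (MvPolynomial (Fin s) ℂ) R a) = MvPolynomial.eval y a) ∧
      ∀ c, φ (x c) = ξ y t c := by
    intro y t hy ht
    obtain ⟨φ, hφ⟩ := exists_algHom_of_evalPair_eq_zero (by rw [hxmk]; exact hmk) hdvd hq hy ht
    have hφ' : ∀ a, φ (algebraMap (MvPolynomial (Fin s) ℂ) R a) = MvPolynomial.eval y a := by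
      intro a
      rw [← aeval_C θ, hφ, evalPair_C]
    refine ⟨φ, hφ', fun c => ?_⟩
    rw [eq_div_iff hy, ← hφ', ← hφ, ← hq, Algebra.smul_def, map_mul, mul_comm]
  have hξX : ∀ y t, MvPolynomial.eval y G ≠ 0 → evalPair y t m = 0 → ξ y t ∈ X := by
    intro y t hy ht
    obtain ⟨φ, -, hφ⟩ := hpt y t hy ht
    refine hPX fun p hp => ?_
    rw [show ξ y t = fun c => φ (x c) from funext fun c => (hφ c).symm]
    have h1 := MvPolynomial.comp_aeval_apply x φ p
    rw [hxmk, show mk p = 0 from hp, map_zero] at h1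
    exact h1.symm
  -- Finiteness of the cover makes each coordinate integral over `ℂ[y]`, so it is a root of a monic
  -- polynomial with bounded coefficients.
  have hξb : ∀ r : ℝ, ∃ B : ℝ, ∀ y, ‖y‖ ≤ r → ∀ t, MvPolynomial.eval y G ≠ 0 →
      evalPair y t m = 0 → ‖ξ y t‖ ≤ B := by
    intro r
    have hint : ∀ c, IsIntegral (MvPolynomial (Fin s) ℂ) (x c) := fun c =>
      Algebra.IsIntegral.isIntegral _
    choose B hB using fun c => exists_bound_of_evalPair_eq_zero (minpoly.monic (hint c)) r
    refine ⟨∑ c, |B c|, fun y hy t hGy ht => ?_⟩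
    obtain ⟨φ, h1, h2⟩ := hpt y t hGy ht
    rw [pi_norm_le_iff_of_nonneg (Finset.sum_nonneg fun _ _ => abs_nonneg _)]
    intro c
    refine ((hB c y hy _ ?_).trans (le_abs_self _)).trans
      (Finset.single_le_sum (f := fun c => |B c|) (fun _ _ => abs_nonneg _) (Finset.mem_univ c))
    rw [← h2, ← algHom_aeval_eq_evalPair h1, minpoly.aeval, map_zero]
  have hξd : ∀ y t, MvPolynomial.eval y G ≠ 0 →
      DifferentiableAt ℂ (fun u : (Fin s → ℂ) × ℂ => ξ u.1 u.2) (y, t) := by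
    intro y t hy
    rw [differentiableAt_pi]
    intro c
    have h1 := (analyticAt_evalPair (q c) (y, t)).differentiableAt
    have h2 := (analyticAt_evalPair (C G) (y, t)).differentiableAt
    simp only [evalPair_C] at h2
    simp only [ξ, div_eq_mul_inv]
    exact h1.fun_mul (h2.fun_inv hy)
  let F : ℕ → (Fin s → ℂ) → ℂ := fun l y => MvPolynomial.eval y G ^ 2 *
    ∑ t ∈ rootsAt m y, Function.extend Subtype.val (f : C(X, ℂ)) 0 (ξ y t) * t ^ l
  have hF : ∀ l, Differentiable ℂ (F l) := fun l =>
    differentiable_weightedPowerSum hX f hm hsep hξd hξX hξb l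
  have hYc : Continuous fun x : X => fun i => MvPolynomial.eval (x : ι → ℂ) (Y i) :=
    continuous_pi fun i => (MvPolynomial.continuous_eval (Y i)).comp continuous_subtype_val
  let FY : ℕ → C(X, ℂ) := fun l => ⟨fun x => F l fun i => MvPolynomial.eval (x : ι → ℂ) (Y i),
    (hF l).continuous.comp hYc⟩
  refine ⟨∑ k ∈ Finset.range (m.natDegree + 1), (polyFun X (MvPolynomial.aeval Y (m.coeff k)) *
    ∑ i ∈ Finset.range k, (polyFun X (Θ ^ i) : C(X, ℂ)) * FY (k - 1 - i)), ?_, fun z hz => ?_⟩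
  · refine sum_mem fun k _ => mul_mem (polyFun_mem_polyClosure _ _) (sum_mem fun i _ =>
      mul_mem (polyFun_mem_polyClosure _ _) (entire_comp_mem_polyClosure (hF _) Y fun _ => rfl))
  obtain ⟨φ, hφ⟩ := exists_algHom_comp_eq hmk (f := MvPolynomial.aeval (z : ι → ℂ)) fun p hp => hz p hp
  change ∀ p, φ (mk p) = MvPolynomial.eval (z : ι → ℂ) p at hφ
  set y : Fin s → ℂ := fun i => MvPolynomial.eval (z : ι → ℂ) (Y i) with hy
  have hYeval : ∀ a, MvPolynomial.eval (z : ι → ℂ) (MvPolynomial.aeval Y a) =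
      MvPolynomial.eval y a := fun a =>
    MvPolynomial.comp_aeval_apply Y (MvPolynomial.aeval (z : ι → ℂ)) a
  have hφa : ∀ a, φ (algebraMap (MvPolynomial (Fin s) ℂ) R a) = MvPolynomial.eval y a := by
    intro a
    change φ (g a) = _
    rw [hgY, hφ, hYeval]
  set t : ℂ := MvPolynomial.eval (z : ι → ℂ) Θ with ht
  have hφθ : φ θ = t := by rw [← hΘ, hφ]
  have hev : ∀ p, φ (aeval θ p) = evalPair y t p := fun p => by
    rw [algHom_aeval_eq_evalPair hφa, hφθ]
  have htm : evalPair y t m = 0 := by rw [← hev, hmθ, map_zero]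
  have hHz : MvPolynomial.eval (z : ι → ℂ) H =
      MvPolynomial.eval y G ^ 2 * evalPair y t (derivative m) := by
    rw [← hφ, hH, map_mul, map_pow, hφa, hev]
  rw [hHz]
  simp only [ContinuousMap.sum_apply, ContinuousMap.mul_apply, polyFun_apply, hYeval]
  simp only [map_pow, ← ht, FY, ContinuousMap.coe_mk, F, ← hy]
  -- Where `G` vanishes both sides contain the factor `G²`; elsewhere `z` is the fibre point
  -- belonging to its own root `t`.
  by_cases hGy : MvPolynomial.eval y G = 0
  · simp [hGy]
  have hξz : ξ y t = z := by
    funext c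
    rw [div_eq_iff hGy, ← hev, ← hq, Algebra.smul_def, map_mul, hφa, mul_comm]
    congr 1
    simp [x, hφ]
  have hswap : ∑ k ∈ Finset.range (m.natDegree + 1), MvPolynomial.eval y (m.coeff k) *
      ∑ i ∈ Finset.range k, t ^ i * (MvPolynomial.eval y G ^ 2 *
        ∑ u ∈ rootsAt m y, Function.extend Subtype.val (f : C(X, ℂ)) 0 (ξ y u) * u ^ (k - 1 - i)) =
      MvPolynomial.eval y G ^ 2 * ∑ u ∈ rootsAt m y,
        Function.extend Subtype.val (f : C(X, ℂ)) 0 (ξ y u) *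
        ∑ k ∈ Finset.range (m.natDegree + 1), MvPolynomial.eval y (m.coeff k) *
          ∑ i ∈ Finset.range k, t ^ i * u ^ (k - 1 - i) := by
    simp only [Finset.mul_sum]
    conv_rhs => rw [Finset.sum_comm]
    refine Finset.sum_congr rfl fun k _ => ?_
    rw [Finset.sum_comm]
    refine Finset.sum_congr rfl fun u _ => Finset.sum_congr rfl fun i _ => ?_
    ring
  rw [hswap]
  have hin : ∀ u ∈ rootsAt m y, Function.extend Subtype.val (f : C(X, ℂ)) 0 (ξ y u) *
        ∑ k ∈ Finset.range (m.natDegree + 1), MvPolynomial.eval y (m.coeff k) *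
          ∑ i ∈ Finset.range k, t ^ i * u ^ (k - 1 - i) =
      if u = t then (f : C(X, ℂ)) z * evalPair y t (derivative m) else 0 := by
    intro u hu
    rw [mem_rootsAt hm, evalPair_eq] at hu
    have h1 := sum_coeff_mul_geom_sum₂ (m.map (MvPolynomial.eval y)) t u
      (by rw [← evalPair_eq, htm]) hu
    simp only [hm.natDegree_map, coeff_map] at h1
    rw [h1]
    split_ifs with hut
    · rw [hut, hξz, derivative_map, ← evalPair_eq]
      congr 1
      exact Subtype.val_injective.extend_apply (f : C(X, ℂ)) 0 z
    · rw [mul_zero]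
  rw [Finset.sum_congr rfl hin, Finset.sum_ite_eq' (rootsAt m y) t, if_pos ((mem_rootsAt hm).2 htm)]
  ring

/-- The multiplier `H` of one component `P` is corrected by a polynomial `e` that vanishes on all
other components but not on `P`. Then `e * H * f = e * Φ` on all of `X`, and the Nullstellensatz
keeps `e * H` nonzero on the component. -/
theorem exists_ne_zero_mul_mem_closure_polyFun {X : Set (ι → ℂ)} (J : Ideal (MvPolynomial ι ℂ))
    (hJ : X = MvPolynomial.zeroLocus ℂ J) (hne : X.Nonempty) :
    ∃ h : HoloFun X, h ≠ 0 ∧ ∀ f : HoloFun X, ((h * f : HoloFun X) : C(X, ℂ)) ∈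
      closure (Set.range fun p => (polyFun X p : C(X, ℂ))) := by
  classical
  have hcl : IsClosed X := by
    rw [hJ, show MvPolynomial.zeroLocus ℂ J = ⋂ p ∈ J, {x | MvPolynomial.eval x p = 0} by
      ext x
      simp [MvPolynomial.zeroLocus, MvPolynomial.aeval_eq_eval]]
    exact isClosed_biInter fun p _ =>
      isClosed_eq (MvPolynomial.continuous_eval p) continuous_const
  have hlc : LocallyCompactSpace X := hcl.isClosedEmbedding_subtypeVal.locallyCompactSpace
  have hprime : ∀ x ∈ X, ∃ Q ∈ J.minimalPrimes, x ∈ MvPolynomial.zeroLocus ℂ Q := by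
    intro x hx
    let φ : MvPolynomial ι ℂ →ₐ[ℂ] ℂ := MvPolynomial.aeval x
    have hp : (RingHom.ker φ).IsPrime := RingHom.ker_isPrime φ
    have hle : J ≤ RingHom.ker φ := fun p hp => by
      rw [hJ] at hx
      exact hx p hp
    obtain ⟨Q, hQ, hQle⟩ := Ideal.exists_minimalPrimes_le hle
    exact ⟨Q, hQ, fun p hp => hQle hp⟩
  obtain ⟨x₀, hx₀⟩ := hne
  obtain ⟨P, hP, -⟩ := hprime x₀ hx₀
  have hPp : P.IsPrime := hP.1.1
  have hPX : MvPolynomial.zeroLocus ℂ P ⊆ X := by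
    rw [hJ]
    exact MvPolynomial.zeroLocus_anti_mono hP.1.2
  have hker : RingHom.ker (Ideal.Quotient.mkₐ ℂ P) = P := Ideal.Quotient.mkₐ_ker ℂ P
  obtain ⟨H, hH', hHf⟩ := exists_polynomial_mul_eq_polyClosure hcl
    (Ideal.Quotient.mkₐ_surjective ℂ P) (by rwa [hker])
  rw [hker] at hHf
  have hH : H ∉ P := fun h => hH' (Ideal.Quotient.eq_zero_iff_mem.2 h)
  have hfin := Ideal.finite_minimalPrimes_of_isNoetherianRing (MvPolynomial ι ℂ) J
  -- A prime containing a product of ideals contains one of them, which minimality of `P` excludes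
  -- for the other minimal primes.
  obtain ⟨e, he, heP⟩ : ∃ e ∈ ∏ Q ∈ hfin.toFinset.erase P, Q, e ∉ P := by
    rw [← SetLike.not_le_iff_exists, hPp.prod_le]
    rintro ⟨Q, hQ, hQP⟩
    rw [Finset.mem_erase, Set.Finite.mem_toFinset] at hQ
    exact hQ.1 (le_antisymm hQP (hP.2 hQ.2.1 hQP))
  refine ⟨polyFun X (e * H), fun h0 => ?_, fun f => ?_⟩
  · have : e * H ∉ MvPolynomial.vanishingIdeal ℂ (MvPolynomial.zeroLocus ℂ P) := by
      rw [MvPolynomial.IsPrime.vanishingIdeal_zeroLocus]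
      exact fun h => (hPp.mem_or_mem h).elim heP hH
    refine this (MvPolynomial.mem_vanishingIdeal_iff.2 fun x hx => ?_)
    have h1 := polyFun_apply (X := X) (e * H) ⟨x, hPX hx⟩
    rw [h0] at h1
    exact h1.symm
  · obtain ⟨Φ, hΦ, hΦf⟩ := hHf f
    have : ((polyFun X (e * H) * f : HoloFun X) : C(X, ℂ)) = (polyFun X e : C(X, ℂ)) * Φ := by
      ext x
      change (polyFun X (e * H) : C(X, ℂ)) x * (f : C(X, ℂ)) x = (polyFun X e : C(X, ℂ)) x * Φ x
      rw [polyFun_apply, polyFun_apply, map_mul]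
      by_cases hx : (x : ι → ℂ) ∈ MvPolynomial.zeroLocus ℂ P
      · rw [← hΦf x hx]
        ring
      · obtain ⟨Q, hQ, hxQ⟩ := hprime x x.2
        have hQP : Q ≠ P := by
          rintro rfl
          exact hx hxQ
        have heQ : e ∈ Q := by
          have := Ideal.prod_le_inf.trans (Finset.inf_le (f := id) (Finset.mem_erase.2
            ⟨hQP, hfin.mem_toFinset.2 hQ⟩))
          exact this he
        have : MvPolynomial.eval (x : ι → ℂ) e = 0 := hxQ e heQ
        rw [this]
        ring
    rw [this]
    have hmem := mul_mem (polyFun_mem_polyClosure X e) hΦ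
    exact hmem

end BranchedCover

/-! ### Compatible tuples of complete fields -/

section Compatible

variable {ι : Type} [Fintype ι] {X : Set (ι → ℂ)}

/-- A vector field on the ambient space whose integral curves through the points of `X` are entire
and stay in `X` restricts to `X`. -/
def HoloVF.ofFlow (X : Set (ι → ℂ)) (W : (ι → ℂ) → ι → ℂ)
    (hW : ∀ c x, AnalyticAt ℂ (fun y => W y c) x)
    (hflow : ∀ x ∈ X, ∃ φ : ℂ → ι → ℂ, φ 0 = x ∧ (∀ t, φ t ∈ X) ∧
      ∀ t, HasDerivAt φ (W (φ t)) t) : HoloVF X where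
  toFun x := W x
  holo c x := ⟨fun y => W y c, hW c x, Filter.Eventually.of_forall fun _ => rfl⟩
  tangent := by
    intro x F hF hFX
    obtain ⟨φ, h0, hX, hφ⟩ := hflow x x.2
    have h1 := hF.differentiableAt.hasFDerivAt.comp_hasDerivAt_of_eq 0 (hφ 0) h0.symm
    rw [h0] at h1
    rw [nhds_subtype_eq_comap, Filter.eventually_comap] at hFX
    -- `F` vanishes on `X` near `x` and the curve stays in `X`, so invariance under the flow already
    -- forces tangency.
    have h2 : F ∘ φ =ᶠ[𝓝 0] fun _ => 0 := by
      have := (hφ 0).continuousAt.tendsto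
      rw [h0] at this
      filter_upwards [this.eventually hFX] with t ht
      exact ht ⟨φ t, hX t⟩ rfl
    exact h1.unique ((hasDerivAt_const (0 : ℂ) (0 : ℂ)).congr_of_eventuallyEq h2)

theorem HoloVF.isComplete_ofFlow (W : (ι → ℂ) → ι → ℂ)
    (hW : ∀ c x, AnalyticAt ℂ (fun y => W y c) x)
    (hflow : ∀ x ∈ X, ∃ φ : ℂ → ι → ℂ, φ 0 = x ∧ (∀ t, φ t ∈ X) ∧
      ∀ t, HasDerivAt φ (W (φ t)) t) : (HoloVF.ofFlow X W hW hflow).IsComplete := by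
  intro x
  obtain ⟨φ, h0, hX, hφ⟩ := hflow x x.2
  exact ⟨fun t => ⟨φ t, hX t⟩, Subtype.ext h0, hφ⟩

theorem HoloVF.mem_ker_iff (θ : HoloVF X) (f : HoloFun X) :
    f ∈ θ.ker ↔ ∀ x, θ.applyFun f x = 0 :=
  ⟨fun h x => congrArg (fun g : HoloFun X => (g : C(X, ℂ)) x) h,
    fun h => Subtype.ext (ContinuousMap.ext h)⟩

theorem HoloVF.applyFun_coordFun (θ : HoloVF X) (c : ι) (x : X) :
    θ.applyFun (coordFun X c) x = θ.toFun x c := by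
  rw [θ.applyFun_eq (coordFun X c) x (F := fun y => y c)
    ((ContinuousLinearMap.proj (R := ℂ) (φ := fun _ : ι => ℂ) c).analyticAt _)
    (Filter.Eventually.of_forall fun _ => rfl)]
  exact congrArg (fun L : (ι → ℂ) →L[ℂ] ℂ => L (θ.toFun x))
    (ContinuousLinearMap.proj (R := ℂ) (φ := fun _ : ι => ℂ) c).fderiv

theorem HoloVF.coordFun_mem_ker_iff (θ : HoloVF X) (c : ι) :
    coordFun X c ∈ θ.ker ↔ ∀ x, θ.toFun x c = 0 := by
  simp only [θ.mem_ker_iff, θ.applyFun_coordFun]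

theorem HoloVF.hasDerivAt_comp (θ : HoloVF X) (f : HoloFun X) {x : X} {φ : ℂ → X} (h0 : φ 0 = x)
    (hφ : HasDerivAt (fun t => (φ t : ι → ℂ)) (θ.toFun x) 0) :
    HasDerivAt (fun t => (f : C(X, ℂ)) (φ t)) (θ.applyFun f x) 0 := by
  obtain ⟨F, hF, hfF⟩ := f.2 x
  rw [θ.applyFun_eq f x hF hfF]
  have hc : Filter.Tendsto φ (𝓝 0) (𝓝 x) := by
    rw [nhds_subtype_eq_comap, Filter.tendsto_comap_iff, ← h0]
    exact hφ.continuousAt.tendsto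
  refine (hF.differentiableAt.hasFDerivAt.comp_hasDerivAt_of_eq 0 hφ (by rw [h0])
    ).congr_of_eventuallyEq ?_
  filter_upwards [hc.eventually hfF] with t ht using ht

/-- The kernel of a field, as a multiplicative submonoid of `𝒪(X)`. -/
def HoloVF.kerSubmonoid (θ : HoloVF X) : Submonoid (HoloFun X) where
  carrier := θ.ker
  one_mem' := by
    rw [θ.mem_ker_iff]
    intro x
    rw [θ.applyFun_eq 1 x (F := fun _ => 1) analyticAt_const (Filter.Eventually.of_forall fun _ => rfl)]
    simp
  mul_mem' := by
    intro f g hf hg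
    rw [θ.mem_ker_iff] at hf hg ⊢
    intro x
    obtain ⟨F, hF, hfF⟩ := f.2 x
    obtain ⟨G, hG, hgG⟩ := g.2 x
    have h1 := hf x
    have h2 := hg x
    rw [θ.applyFun_eq f x hF hfF] at h1
    rw [θ.applyFun_eq g x hG hgG] at h2
    rw [θ.applyFun_eq (f * g) x (hF.mul hG) (by
      filter_upwards [hfF, hgG] with y hy1 hy2
      change (f : C(X, ℂ)) y * (g : C(X, ℂ)) y = F y * G y
      rw [hy1, hy2]), fderiv_mul hF.differentiableAt hG.differentiableAt]
    simp [h1, h2]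

theorem polyFun_mem_span_prod_ker {k : ℕ} (θ : Fin (k + 1) → HoloVF X)
    (h : ∀ c, ∃ i, coordFun X c ∈ (θ i).ker) (p : MvPolynomial ι ℂ) :
    polyFun X p ∈ Submodule.span ℂ
      {g | ∃ f : Fin (k + 1) → HoloFun X, (∀ i, f i ∈ (θ i).ker) ∧ g = ∏ i, f i} := by
  classical
  -- Kernels are closed under multiplication, so the products form a submonoid and their linear span
  -- is already an algebra. Since it contains the coordinates, it contains every polynomial.
  let M : Submonoid (HoloFun X) :=
    { carrier := {g | ∃ f : Fin (k + 1) → HoloFun X, (∀ i, f i ∈ (θ i).ker) ∧ g = ∏ i, f i}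
      one_mem' := ⟨fun _ => 1, fun i => (θ i).kerSubmonoid.one_mem, by simp⟩
      mul_mem' := by
        rintro _ _ ⟨f, hf, rfl⟩ ⟨g, hg, rfl⟩
        exact ⟨fun i => f i * g i, fun i => (θ i).kerSubmonoid.mul_mem (hf i) (hg i),
          Finset.prod_mul_distrib.symm⟩ }
  have hM : polyFun X p ∈ Algebra.adjoin ℂ (M : Set (HoloFun X)) := by
    have h1 : Algebra.adjoin ℂ (Set.range (coordFun X)) ≤ Algebra.adjoin ℂ (M : Set (HoloFun X)) := by
      refine Algebra.adjoin_mono ?_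
      rintro _ ⟨c, rfl⟩
      obtain ⟨i, hi⟩ := h c
      refine ⟨Function.update (fun _ => 1) i (coordFun X c), fun j => ?_, ?_⟩
      · by_cases hj : j = i
        · subst hj
          simpa using hi
        · rw [Function.update_of_ne hj]
          exact (θ j).kerSubmonoid.one_mem
      · rw [Finset.prod_update_of_mem (Finset.mem_univ i)]
        simp
    apply h1
    rw [Algebra.adjoin_range_eq_range_aeval]
    exact ⟨p, rfl⟩
  rw [← Subalgebra.mem_toSubmodule, Algebra.adjoin_eq_span, Submonoid.closure_eq] at hM
  exact hM

theorem exists_ideal_subset_closure_span (J : Ideal (MvPolynomial ι ℂ))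
    (hJ : X = MvPolynomial.zeroLocus ℂ J) (hne : X.Nonempty) {k : ℕ} (θ : Fin (k + 1) → HoloVF X)
    (h : ∀ c, ∃ i, coordFun X c ∈ (θ i).ker) :
    ∃ I : Ideal (HoloFun X), I ≠ ⊥ ∧
      (I : Set (HoloFun X)) ⊆ closure (Submodule.span ℂ
        {g | ∃ f : Fin (k + 1) → HoloFun X, (∀ i, f i ∈ (θ i).ker) ∧ g = ∏ i, f i} :
          Set (HoloFun X)) := by
  obtain ⟨u, hu, hmem⟩ := exists_ne_zero_mul_mem_closure_polyFun J hJ hne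
  refine ⟨Ideal.span {u}, by simpa using hu, fun g hg => ?_⟩
  obtain ⟨f, rfl⟩ := Ideal.mem_span_singleton'.1 hg
  rw [closure_subtype, mul_comm]
  refine closure_mono ?_ (hmem f)
  rintro _ ⟨p, rfl⟩
  exact ⟨polyFun X p, polyFun_mem_span_prod_ker θ h p, rfl⟩

theorem exists_star_tree {k : ℕ} (θ : Fin (k + 1) → HoloVF X) (hinj : Function.Injective θ)
    (h : ∀ i, i ≠ 0 → ∃ f, f ∈ ((θ i).kerSq \ (θ i).ker) ∩ (θ 0).ker) :
    ∃ (Vert : Type) (T : SimpleGraph Vert) (r : Vert) (π : Vert ≃ Set.range θ)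
      (ε : Vert → Vert → HoloFun X),
      T.IsTree ∧ (π r : HoloVF X) = θ 0 ∧
      ∀ v w, T.Adj v w → T.dist w r < T.dist v r →
        ε v w ∈ ((π v : HoloVF X).kerSq \ (π v : HoloVF X).ker) ∩ (π w : HoloVF X).ker := by
  have h' : ∀ i, ∃ f, i ≠ 0 → f ∈ ((θ i).kerSq \ (θ i).ker) ∩ (θ 0).ker := by
    intro i
    by_cases hi : i = 0
    · exact ⟨0, fun h => absurd hi h⟩
    · obtain ⟨f, hf⟩ := h i hi
      exact ⟨f, fun _ => hf⟩
  choose f hf using h'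
  refine ⟨Fin (k + 1), SimpleGraph.starGraph 0, 0, Equiv.ofInjective θ hinj, fun v _ => f v,
    SimpleGraph.isTree_starGraph 0, rfl, fun v w hvw hd => ?_⟩
  have hv : v ≠ 0 := by
    rintro rfl
    simp at hd
  have hw : w = 0 := ((SimpleGraph.starGraph_adj.1 hvw).2).resolve_left hv
  subst hw
  exact hf v hv

/-- The function on the edge from `θ i` to the root is the coordinate `c`. Its second derivative
along `θ i` vanishes because the `c`-component of `θ i` is constant along a curve with velocity `θ
i`. -/
theorem isCompatibleTuple_of_coordFun (J : Ideal (MvPolynomial ι ℂ))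
    (hJ : X = MvPolynomial.zeroLocus ℂ J) {k : ℕ} {θ : Fin (k + 1) → HoloVF X}
    (hne : X.Nonempty) (hθ : ∀ i, (θ i).IsComplete) (hinj : Function.Injective θ)
    (hker : ∀ c, ∃ i, ∀ x, (θ i).toFun x c = 0)
    (htree : ∀ i, i ≠ 0 → ∃ c, (∀ x, (θ 0).toFun x c = 0) ∧ (∃ x, (θ i).toFun x c ≠ 0) ∧
      ∀ x, ∃ φ : ℂ → X, φ 0 = x ∧ HasDerivAt (fun t => (φ t : ι → ℂ)) ((θ i).toFun x) 0 ∧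
        ∀ t, (θ i).toFun (φ t) c = (θ i).toFun x c) :
    IsCompatibleTuple θ := by
  refine ⟨hθ, exists_ideal_subset_closure_span J hJ hne θ fun c => ?_,
    exists_star_tree θ hinj fun i hi => ?_⟩
  · obtain ⟨i, hi⟩ := hker c
    exact ⟨i, ((θ i).coordFun_mem_ker_iff c).2 hi⟩
  · obtain ⟨c, h0, ⟨x, hx⟩, h2⟩ := htree i hi
    refine ⟨coordFun X c, ⟨?_, fun h => hx (((θ i).coordFun_mem_ker_iff c).1 h x)⟩,
      ((θ 0).coordFun_mem_ker_iff c).2 h0⟩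
    change (θ i).apply (coordFun X c) ∈ (θ i).ker
    rw [(θ i).mem_ker_iff]
    intro x
    obtain ⟨φ, hφ0, hφ, hconst⟩ := h2 x
    refine ((θ i).hasDerivAt_comp _ hφ0 hφ).unique ?_
    have : (fun t => (((θ i).apply (coordFun X c) : HoloFun X) : C(X, ℂ)) (φ t)) =
        fun _ => (θ i).toFun x c := by
      funext t
      exact ((θ i).applyFun_coordFun c (φ t)).trans (hconst t)
    rw [this]
    exact hasDerivAt_const _ _

end Compatible

/-! ### Linear flows -/

section Flows

/-- `E` is the integral of `exp (b s)` from `0` to `t`, which treats `b = 0` and `b ≠ 0` uniformly.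
-/
theorem exists_primitive_exp (b : ℂ) : ∃ E : ℂ → ℂ, E 0 = 0 ∧
    (∀ t, HasDerivAt E (Complex.exp (b * t)) t) ∧ ∀ t, 1 + b * E t = Complex.exp (b * t) := by
  by_cases hb : b = 0
  · subst hb
    exact ⟨id, rfl, fun t => by simpa using hasDerivAt_id t, fun t => by simp⟩
  · refine ⟨fun t => (Complex.exp (b * t) - 1) / b, by simp, fun t => ?_, fun t => by field_simp; ring⟩
    have h1 : HasDerivAt (fun t => b * t) b t := by simpa using (hasDerivAt_id t).const_mul b
    have h2 := (h1.cexp.sub_const 1).div_const b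
    rwa [mul_div_assoc, div_self hb, mul_one] at h2

/-- The coordinate `u` grows exponentially at rate `κ u`, each other `c ≠ w` is an integral of a
multiple of it, and `w` solves a scalar affine equation. The coordinates outside `S` never move, so
the form of `W` is needed only on the slice through `x₀`. -/
theorem exists_linear_flow {ι : Type} [Fintype ι] [DecidableEq ι] {W : (ι → ℂ) → ι → ℂ} {u w : ι}
    (huw : u ≠ w) {S : Set ι} (hw : w ∈ S) {x₀ : ι → ℂ} {κ : ι → ℂ} {α β : ℂ}
    (hκ : ∀ c ∉ S, κ c = 0)
    (hW : ∀ x : ι → ℂ, (∀ c ∉ S, x c = x₀ c) → (∀ c, c ≠ w → W x c = x u * κ c) ∧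
      W x w = α + β * x w) :
    ∃ φ : ℂ → ι → ℂ, φ 0 = x₀ ∧ ∀ t, HasDerivAt φ (W (φ t)) t := by
  obtain ⟨E, hE0, hEd, hE⟩ := exists_primitive_exp (κ u)
  obtain ⟨E', hE0', hEd', hE'⟩ := exists_primitive_exp β
  let φ : ℂ → ι → ℂ := fun t c => if c = w then x₀ w + (α + β * x₀ w) * E' t
    else x₀ c + x₀ u * κ c * E t
  refine ⟨φ, ?_, fun t => ?_⟩
  · funext c
    by_cases hc : c = w
    · simp [φ, hc, hE0']
    · simp [φ, hc, hE0]
  · have hS : ∀ c ∉ S, φ t c = x₀ c := by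
      intro c hc
      have hcw : c ≠ w := fun h => hc (h ▸ hw)
      simp [φ, hcw, hκ c hc]
    obtain ⟨h1, h2⟩ := hW (φ t) hS
    rw [hasDerivAt_pi]
    intro c
    by_cases hc : c = w
    · subst hc
      rw [h2]
      have h3 := ((hEd' t).const_mul (α + β * x₀ c)).const_add (x₀ c)
      have h4 : (fun t => φ t c) = fun t => x₀ c + (α + β * x₀ c) * E' t := by
        funext t
        simp [φ]
      rw [h4]
      convert h3 using 1
      rw [← hE']
      simp only [φ, if_true]
      ring
    · rw [h1 c hc]
      have h3 := ((hEd t).const_mul (x₀ u * κ c)).const_add (x₀ c)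
      have h4 : (fun t => φ t c) = fun t => x₀ c + x₀ u * κ c * E t := by
        funext t
        simp [φ, hc]
      rw [h4]
      convert h3 using 1
      rw [← hE]
      simp only [φ, huw, if_false]
      ring

theorem apply_eq_of_fderiv_eq_zero {ι : Type} [Fintype ι] {W : (ι → ℂ) → ι → ℂ} {p : (ι → ℂ) → ℂ}
    (hp : Differentiable ℂ p) (hW : ∀ x, fderiv ℂ p x (W x) = 0) {φ : ℂ → ι → ℂ}
    (hφ : ∀ t, HasDerivAt φ (W (φ t)) t) (t : ℂ) : p (φ t) = p (φ 0) := by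
  have h : ∀ t, HasDerivAt (p ∘ φ) 0 t := fun t => by
    rw [← hW (φ t)]
    exact (hp (φ t)).hasFDerivAt.comp_hasDerivAt t (hφ t)
  exact is_const_of_deriv_eq_zero (fun t => (h t).differentiableAt) (fun t => (h t).deriv) t 0

end Flows

/-! ### Jacobian fields -/

section Jacobian

open Matrix

variable {ι : Type} [DecidableEq ι] {l : ℕ}

theorem jacobianField_eq_sum (p : (ι → ℂ) → (Fin l → ℂ)) (y : Fin (l + 1) → ι) (x : ι → ℂ) :
    jacobianField p y x = ∑ j : Fin (l + 1), ((-1) ^ (j : ℕ) * det (of fun i k : Fin l =>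
      fderiv ℂ (fun x' => p x' i) x (Pi.single (y (j.succAbove k)) 1))) •
        (Pi.single (y j) 1 : ι → ℂ) := by
  funext c
  rw [jacobianField, det_succ_row_zero, Finset.sum_apply]
  refine Finset.sum_congr rfl fun j _ => ?_
  simp only [of_apply, Fin.cons_zero, Pi.smul_apply, smul_eq_mul]
  rw [mul_right_comm]
  rfl

theorem fderiv_jacobianField_eq_zero (p : (ι → ℂ) → (Fin l → ℂ)) (y : Fin (l + 1) → ι) (x : ι → ℂ)
    (i : Fin l) : fderiv ℂ (fun x' => p x' i) x (jacobianField p y x) = 0 := by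
  rw [jacobianField_eq_sum, map_sum]
  let A : Matrix (Fin (l + 1)) (Fin (l + 1)) ℂ :=
    of (Fin.cons (fun j => fderiv ℂ (fun x' => p x' i) x (Pi.single (y j) 1))
      (fun i j => fderiv ℂ (fun x' => p x' i) x (Pi.single (y j) 1)))
  have hA : A.det = 0 := det_zero_of_row_eq (Fin.succ_ne_zero i).symm rfl
  rw [← hA, det_succ_row_zero]
  refine Finset.sum_congr rfl fun j _ => ?_
  rw [map_smul, smul_eq_mul, mul_right_comm]
  rfl

theorem jacobianField_apply (p : (ι → ℂ) → (Fin l → ℂ)) {y : Fin (l + 1) → ι}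
    (hy : Function.Injective y) (x : ι → ℂ) (j : Fin (l + 1)) :
    jacobianField p y x (y j) = (-1) ^ (j : ℕ) * det (of fun i k : Fin l =>
      fderiv ℂ (fun x' => p x' i) x (Pi.single (y (j.succAbove k)) 1)) := by
  rw [jacobianField_eq_sum, Finset.sum_apply, Finset.sum_eq_single j]
  · simp
  · intro k _ hk
    simp [Pi.single_eq_of_ne (hy.ne hk.symm)]
  · simp

theorem jacobianField_apply_of_notMem (p : (ι → ℂ) → (Fin l → ℂ)) {y : Fin (l + 1) → ι}
    (x : ι → ℂ) {c : ι} (hc : c ∉ Set.range y) : jacobianField p y x c = 0 := by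
  rw [jacobianField_eq_sum, Finset.sum_apply]
  refine Finset.sum_eq_zero fun j _ => ?_
  rw [Pi.smul_apply, Pi.single_eq_of_ne (fun h => hc ⟨j, h.symm⟩), smul_zero]

/-- The Jacobian field of a map which is affine in `(y_0, …, y_{l-1}, y_0 y_l)` has entire
integral curves. -/
theorem exists_flow_jacobianField [Fintype ι] {p : (ι → ℂ) → (Fin l → ℂ)} {y : Fin (l + 1) → ι}
    (hy : Function.Injective y) (i₀ : Fin l) (x₀ : ι → ℂ) (A : Fin l → Fin l → ℂ) (d : Fin l → ℂ)
    (h1 : ∀ x : ι → ℂ, (∀ c ∉ Set.range y, x c = x₀ c) → ∀ i k,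
      fderiv ℂ (fun x' => p x' i) x (Pi.single (y (Fin.castSucc k)) 1) =
        A k i + if k = i₀ then x (y (Fin.last l)) * d i else 0)
    (h2 : ∀ x : ι → ℂ, (∀ c ∉ Set.range y, x c = x₀ c) → ∀ i,
      fderiv ℂ (fun x' => p x' i) x (Pi.single (y (Fin.last l)) 1) =
        x (y (Fin.castSucc i₀)) * d i) :
    ∃ φ : ℂ → ι → ℂ, φ 0 = x₀ ∧ ∀ t, HasDerivAt φ (jacobianField p y (φ t)) t := by
  let B : Matrix (Fin l) (Fin l) ℂ := of fun i k => A k i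
  -- Omitting the column of `y_l` leaves `y_l` in the column `i₀` only, and affinely, so this
  -- component is affine in `y_l`.
  have hlast : ∀ x : ι → ℂ, (∀ c ∉ Set.range y, x c = x₀ c) →
      jacobianField p y x (y (Fin.last l)) = (-1) ^ l * B.det +
        (-1) ^ l * (B.updateCol i₀ d).det * x (y (Fin.last l)) := by
    intro x hx
    have : (of fun i k : Fin l => fderiv ℂ (fun x' => p x' i) x
        (Pi.single (y ((Fin.last l).succAbove k)) 1)) =
        B.updateCol i₀ ((fun i => B i i₀) + x (y (Fin.last l)) • d) := by
      ext i k
      rw [of_apply, Fin.succAbove_last, h1 x hx]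
      by_cases hk : k = i₀
      · subst hk
        simp [B]
      · simp [B, hk]
    rw [jacobianField_apply p hy, this, det_updateCol_add, det_updateCol_smul]
    have hB : B.updateCol i₀ (fun i => B i i₀) = B := updateCol_eq_self B i₀
    rw [hB, Fin.val_last]
    ring
  -- For the other components the column of `y_l` is `y_{i₀} d`, from which `y_{i₀}` is pulled out.
  -- The remaining `y_l d` in column `i₀`, if that column is present, is a multiple of the column
  -- `d` and disappears by a column operation; so `D j` no longer involves `y`.
  let D : Fin (l + 1) → Matrix (Fin l) (Fin l) ℂ := fun j => of fun i k =>
    if h : j.succAbove k = Fin.last l then d i else A ((j.succAbove k).castPred h) i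
  have hinit : ∀ x : ι → ℂ, (∀ c ∉ Set.range y, x c = x₀ c) → ∀ j, j ≠ Fin.last l →
      jacobianField p y x (y j) = x (y (Fin.castSucc i₀)) * ((-1) ^ (j : ℕ) * (D j).det) := by
    intro x hx j hj
    obtain ⟨m, hm⟩ := Fin.exists_succAbove_eq hj.symm
    let D' : Matrix (Fin l) (Fin l) ℂ := of fun i k =>
      if h : j.succAbove k = Fin.last l then d i else A ((j.succAbove k).castPred h) i +
        if (j.succAbove k).castPred h = i₀ then x (y (Fin.last l)) * d i else 0
    have e1 : (of fun i k : Fin l => fderiv ℂ (fun x' => p x' i) x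
        (Pi.single (y (j.succAbove k)) 1)) =
        D'.updateCol m (x (y (Fin.castSucc i₀)) • fun i => D' i m) := by
      ext i k
      rw [of_apply]
      by_cases hk : k = m
      · subst hk
        rw [hm, h2 x hx]
        simp [D', hm]
      · have hne : j.succAbove k ≠ Fin.last l := fun h =>
          hk (Fin.succAbove_right_injective (h.trans hm.symm))
        rw [updateCol_ne hk]
        simp only [D', of_apply, dif_neg hne]
        rw [← h1 x hx, Fin.castSucc_castPred]
    have e2 : D'.det = (D j).det := by
      by_cases hex : ∃ k, j.succAbove k = Fin.castSucc i₀
      · obtain ⟨k₀, hk₀⟩ := hex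
        have hne : k₀ ≠ m := by
          rintro rfl
          exact (Fin.castSucc_lt_last i₀).ne (hk₀.symm.trans hm)
        have e3 : D' = (D j).updateCol k₀ (fun i => D j i k₀ + x (y (Fin.last l)) • D j i m) := by
          ext i k
          by_cases hk : k = k₀
          · subst hk
            simp [D', D, hm, hk₀]
          · rw [updateCol_ne hk]
            simp only [D', D, of_apply]
            split_ifs with h h'
            · rfl
            · exfalso
              apply hk
              apply Fin.succAbove_right_injective (p := j)
              rw [hk₀, ← h', Fin.castSucc_castPred]
            · rw [add_zero]
        rw [e3, det_updateCol_add_smul_self _ hne]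
      · congr 1
        ext i k
        simp only [D', D, of_apply]
        split_ifs with h h'
        · rfl
        · exact absurd ⟨k, by rw [← h', Fin.castSucc_castPred]⟩ hex
        · rw [add_zero]
    rw [jacobianField_apply p hy, e1, det_updateCol_smul, updateCol_eq_self, e2]
    ring
  refine exists_linear_flow (u := y (Fin.castSucc i₀)) (w := y (Fin.last l))
    (hy.ne (Fin.castSucc_lt_last i₀).ne) (S := Set.range y) ⟨_, rfl⟩
    (κ := fun c => ∑ j, if c = y j then (-1) ^ (j : ℕ) * (D j).det else 0) ?_ fun x hx =>
      ⟨fun c hc => ?_, hlast x hx⟩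
  · intro c hc
    exact Finset.sum_eq_zero fun j _ => if_neg fun h => hc ⟨j, h.symm⟩
  · by_cases hcy : c ∈ Set.range y
    · obtain ⟨j, rfl⟩ := hcy
      simp only [hy.eq_iff]
      rw [Finset.sum_ite_eq, if_pos (Finset.mem_univ j)]
      exact hinit x hx j fun h => hc (h ▸ rfl)
    · rw [jacobianField_apply_of_notMem p x hcy, Finset.sum_eq_zero, mul_zero]
      exact fun j _ => if_neg fun h => hcy ⟨j, h.symm⟩

end Jacobian

/-! ### The defining polynomials of the Gromov–Vaserstein varieties -/

section GVPolynomials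

open Matrix

variable {n K : ℕ}

/-- A function on `ℂ^ι` is polynomial. -/
def IsPolyFun {ι : Type} (f : (ι → ℂ) → ℂ) : Prop :=
  ∃ p : MvPolynomial ι ℂ, ∀ x, MvPolynomial.eval x p = f x

theorem IsPolyFun.const {ι : Type} (a : ℂ) : IsPolyFun fun _ : ι → ℂ => a :=
  ⟨MvPolynomial.C a, by simp⟩

theorem IsPolyFun.coord {ι : Type} (c : ι) : IsPolyFun fun x : ι → ℂ => x c :=
  ⟨MvPolynomial.X c, by simp⟩

theorem IsPolyFun.add {ι : Type} {f g : (ι → ℂ) → ℂ} (hf : IsPolyFun f) (hg : IsPolyFun g) :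
    IsPolyFun fun x => f x + g x := by
  obtain ⟨p, hp⟩ := hf
  obtain ⟨q, hq⟩ := hg
  exact ⟨p + q, by simp [hp, hq]⟩

theorem IsPolyFun.mul {ι : Type} {f g : (ι → ℂ) → ℂ} (hf : IsPolyFun f) (hg : IsPolyFun g) :
    IsPolyFun fun x => f x * g x := by
  obtain ⟨p, hp⟩ := hf
  obtain ⟨q, hq⟩ := hg
  exact ⟨p * q, by simp [hp, hq]⟩

theorem IsPolyFun.neg {ι : Type} {f : (ι → ℂ) → ℂ} (hf : IsPolyFun f) :
    IsPolyFun fun x => -f x := by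
  obtain ⟨p, hp⟩ := hf
  exact ⟨-p, by simp [hp]⟩

theorem IsPolyFun.sub {ι : Type} {f g : (ι → ℂ) → ℂ} (hf : IsPolyFun f) (hg : IsPolyFun g) :
    IsPolyFun fun x => f x - g x := by
  simpa only [sub_eq_add_neg] using hf.add hg.neg

theorem IsPolyFun.sum {ι κ : Type} {s : Finset κ} {f : κ → (ι → ℂ) → ℂ}
    (hf : ∀ k, IsPolyFun (f k)) : IsPolyFun fun x => ∑ k ∈ s, f k x := by
  choose p hp using hf
  exact ⟨∑ k ∈ s, p k, by simp [hp]⟩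

theorem IsPolyFun.analyticAt {ι : Type} [Fintype ι] {f : (ι → ℂ) → ℂ} (hf : IsPolyFun f)
    (x : ι → ℂ) : AnalyticAt ℂ f x := by
  obtain ⟨p, hp⟩ := hf
  rw [← funext hp]
  exact AnalyticOnNhd.eval_mvPolynomial p x trivial

theorem isPolyFun_gvSeq (k : ℕ) (i j : Fin n) :
    IsPolyFun fun x : GVIndex n K → ℂ => gvSeq x k s(i, j) := by
  unfold gvSeq
  by_cases h : k ∈ Set.Icc 2 K
  · simp only [dif_pos h]
    exact .coord _
  · simp only [dif_neg h]
    by_cases h1 : k = 1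
    · simp only [if_pos h1, Sym2.lift_mk]
      split_ifs
      · exact .coord _
      · exact .coord _
      · exact .const 0
    · simp only [if_neg h1]
      exact .const 0

theorem isPolyFun_gvMap (k : ℕ) (b : Fin n ⊕ Fin n) :
    IsPolyFun fun x : GVIndex n K → ℂ => gvMap (gvSeq x) k b := by
  induction k generalizing b with
  | zero => exact .const _
  | succ k ih =>
    simp only [gvMap, vecMul, dotProduct]
    refine .sum fun c => (ih c).mul ?_
    unfold elemMatrix symMatrix
    split_ifs
    · rcases c with c | c <;> rcases b with b | b <;> simp only [fromBlocks_apply₁₁,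
        fromBlocks_apply₁₂, fromBlocks_apply₂₁, fromBlocks_apply₂₂, of_apply]
      exacts [.const _, isPolyFun_gvSeq _ _ _, .const _, .const _]
    · rcases c with c | c <;> rcases b with b | b <;> simp only [fromBlocks_apply₁₁,
        fromBlocks_apply₁₂, fromBlocks_apply₂₁, fromBlocks_apply₂₂, of_apply]
      exacts [.const _, .const _, isPolyFun_gvSeq _ _ _, .const _]

theorem isPolyFun_gvPoly (j : Fin n) : IsPolyFun fun x : GVIndex n K → ℂ => gvPoly n K x j := by
  unfold gvPoly
  split_ifs
  · exact isPolyFun_gvMap _ _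
  · exact isPolyFun_gvMap _ _

theorem differentiable_gvPoly (j : Fin n) :
    Differentiable ℂ fun x : GVIndex n K → ℂ => gvPoly n K x j := fun x =>
  ((isPolyFun_gvPoly j).analyticAt x).differentiableAt

theorem exists_gvVariety_eq_zeroLocus (a : Fin n → ℂ) :
    ∃ J : Ideal (MvPolynomial (GVIndex n K) ℂ),
      gvVariety n K a = MvPolynomial.zeroLocus ℂ J := by
  choose p hp using fun j => isPolyFun_gvPoly (K := K) (n := n) j
  refine ⟨Ideal.span (Set.range fun j => p j - MvPolynomial.C (a j)), ?_⟩
  ext x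
  rw [MvPolynomial.zeroLocus_span]
  simp only [gvVariety, Set.mem_ofPred_eq, Set.forall_mem_range, map_sub, MvPolynomial.aeval_eq_eval,
    MvPolynomial.eval_C, sub_eq_zero]
  rw [funext_iff]
  simp [hp]

theorem isPolyFun_fderiv {ι : Type} [Fintype ι] {f : (ι → ℂ) → ℂ} (hf : IsPolyFun f) (v : ι → ℂ)
    (x : ι → ℂ) : AnalyticAt ℂ (fun y => fderiv ℂ f y v) x :=
  (ContinuousLinearMap.apply ℂ ℂ v).analyticAt _ |>.comp (hf.analyticAt x).fderiv

theorem analyticAt_jacobianField {ι : Type} [Fintype ι] [DecidableEq ι] {l : ℕ}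
    {p : (ι → ℂ) → (Fin l → ℂ)} (hp : ∀ i, IsPolyFun fun x => p x i) (y : Fin (l + 1) → ι) (c : ι)
    (x : ι → ℂ) : AnalyticAt ℂ (fun x => jacobianField p y x c) x := by
  simp only [jacobianField, det_apply]
  refine Finset.analyticAt_fun_sum _ fun σ _ => AnalyticAt.const_smul ?_
  refine Finset.analyticAt_fun_prod _ fun i _ => ?_
  refine Fin.cases ?_ (fun j => ?_) (σ i)
  · simp only [of_apply, Fin.cons_zero]
    exact analyticAt_const
  · simp only [of_apply, Fin.cons_succ]
    exact isPolyFun_fderiv (hp j) _ x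

end GVPolynomials

/-! ### Dependence of the defining polynomials on `Z_1` and `Z_2`, and the flow of `V`. -/

section GVSlices

open Matrix

variable {n K : ℕ}

theorem gvSeq_one_last (x : GVIndex n K → ℂ) (i j : Fin n) (hi : (i : ℕ) + 1 = n) :
    gvSeq x 1 s(i, j) = x (Sum.inl j) := by
  simp [gvSeq, hi]

theorem gvSeq_of_mem (x : GVIndex n K → ℂ) {k : ℕ} (hk : k ∈ Set.Icc 2 K) (e : Sym2 (Fin n)) :
    gvSeq x k e = x (Sum.inr (⟨k, hk⟩, e)) := by
  simp only [gvSeq, dif_pos hk]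

theorem gvMap_gvSeq_one (x : GVIndex n K → ℂ) :
    gvMap (gvSeq x) 1 = Sum.elim (fun j => x (Sum.inl j)) (lastVec n) := by
  rw [gvMap_one]
  congr 1
  funext j
  have hn : 0 < n := j.pos
  have hlast : ∀ i : Fin n, lastVec n i = if i = ⟨n - 1, by omega⟩ then 1 else 0 := by
    intro i
    unfold lastVec
    congr 1
    rw [eq_iff_iff, Fin.ext_iff]
    simp only
    omega
  simp only [vecMul, dotProduct, hlast, ite_mul, one_mul, zero_mul, Finset.sum_ite_eq',
    Finset.mem_univ, if_true, symMatrix, of_apply]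
  exact gvSeq_one_last x _ j (by simp only; omega)

theorem gvMap_succ_of_even (Z : ℕ → Sym2 (Fin n) → ℂ) {k : ℕ} (hk : Even (k + 1)) :
    gvMap Z (k + 1) = Sum.elim (fun j => gvMap Z k (Sum.inl j))
      (fun j => (∑ i, gvMap Z k (Sum.inl i) * Z (k + 1) s(i, j)) + gvMap Z k (Sum.inr j)) := by
  rw [gvMap, elemMatrix, if_pos hk, vecMul_fromBlocks]
  congr 1
  · funext j
    simp
  · funext j
    simp [vecMul, dotProduct, symMatrix]

theorem gvMap_succ_of_odd (Z : ℕ → Sym2 (Fin n) → ℂ) {k : ℕ} (hk : ¬ Even (k + 1)) :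
    gvMap Z (k + 1) = Sum.elim
      (fun j => gvMap Z k (Sum.inl j) + ∑ i, gvMap Z k (Sum.inr i) * Z (k + 1) s(i, j))
      (fun j => gvMap Z k (Sum.inr j)) := by
  rw [gvMap, elemMatrix, if_neg hk, vecMul_fromBlocks]
  congr 1
  · funext j
    simp [vecMul, dotProduct, symMatrix]
  · funext j
    simp

/-- The product `M_3(Z_3) ⋯ M_{k+2}(Z_{k+2})`. -/
def tailProd (Z : ℕ → Sym2 (Fin n) → ℂ) : ℕ → Matrix (Fin n ⊕ Fin n) (Fin n ⊕ Fin n) ℂ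
  | 0 => 1
  | k + 1 => tailProd Z k * elemMatrix (k + 3) (Z (k + 3))

theorem gvMap_add_two (Z : ℕ → Sym2 (Fin n) → ℂ) (k : ℕ) :
    gvMap Z (k + 2) = vecMul (gvMap Z 2) (tailProd Z k) := by
  induction k with
  | zero => simp [tailProd]
  | succ k ih =>
    rw [tailProd, ← vecMul_vecMul, ← ih]
    rfl

theorem tailProd_congr {Z Z' : ℕ → Sym2 (Fin n) → ℂ} (h : ∀ k, 3 ≤ k → Z k = Z' k) (k : ℕ) :
    tailProd Z k = tailProd Z' k := by
  induction k with
  | zero => rfl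
  | succ k ih => rw [tailProd, tailProd, ih, h _ (by omega)]

/-- The defining polynomials as a function of the first two matrices. -/
theorem gvPoly_eq_sum (hK : 2 ≤ K) (x : GVIndex n K → ℂ) (j : Fin n) :
    gvPoly n K x j = ∑ i, x (Sum.inl i) *
        tailProd (gvSeq x) (K - 2) (Sum.inl i) (if Even K then Sum.inr j else Sum.inl j) +
      ∑ i, ((∑ k, x (Sum.inl k) * gvSeq x 2 s(k, i)) + lastVec n i) *
        tailProd (gvSeq x) (K - 2) (Sum.inr i) (if Even K then Sum.inr j else Sum.inl j) := by
  have h : ∀ b, gvMap (gvSeq x) K b = ∑ i, x (Sum.inl i) *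
        tailProd (gvSeq x) (K - 2) (Sum.inl i) b +
      ∑ i, ((∑ k, x (Sum.inl k) * gvSeq x 2 s(k, i)) + lastVec n i) *
        tailProd (gvSeq x) (K - 2) (Sum.inr i) b := by
    intro b
    obtain ⟨k, rfl⟩ := Nat.exists_eq_add_of_le' hK
    rw [gvMap_add_two, gvMap_succ_of_even _ (by decide), gvMap_gvSeq_one]
    simp [vecMul, dotProduct, Fintype.sum_sum_type]
  unfold gvPoly
  split_ifs <;> exact h _

/-- The coordinates `(z_{1,n1}, …, z_{1,nn}, z_{2,11})`. -/
def yIdx (hn : 2 ≤ n) (hK : 2 ≤ K) : Fin (n + 1) → GVIndex n K :=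
  Fin.snoc (fun j : Fin n => zIdx K j j.2) (wIdx 2 0 0 (by omega) (by omega) (by omega))

theorem yIdx_castSucc (hn : 2 ≤ n) (hK : 2 ≤ K) (j : Fin n) :
    yIdx hn hK (Fin.castSucc j) = Sum.inl j := by
  simp [yIdx, zIdx]

theorem yIdx_last (hn : 2 ≤ n) (hK : 2 ≤ K) :
    yIdx hn hK (Fin.last n) =
      Sum.inr (⟨2, le_rfl, hK⟩, s(⟨0, by omega⟩, ⟨0, by omega⟩)) := by
  simp [yIdx, wIdx]

theorem yIdx_injective (hn : 2 ≤ n) (hK : 2 ≤ K) : Function.Injective (yIdx hn hK) := by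
  intro i j h
  induction i using Fin.lastCases with
  | last =>
    induction j using Fin.lastCases with
    | last => rfl
    | cast j => simp [yIdx_last, yIdx_castSucc] at h
  | cast i =>
    induction j using Fin.lastCases with
    | last => simp [yIdx_last, yIdx_castSucc] at h
    | cast j =>
      simp only [yIdx_castSucc, Sum.inl.injEq] at h
      rw [h]

theorem inr_mem_range_yIdx (hn : 2 ≤ n) (hK : 2 ≤ K) {e : Set.Icc 2 K × Sym2 (Fin n)}
    (h : (Sum.inr e : GVIndex n K) ∈ Set.range (yIdx hn hK)) :
    e = (⟨2, le_rfl, hK⟩, s(⟨0, by omega⟩, ⟨0, by omega⟩)) := by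
  obtain ⟨i, hi⟩ := h
  induction i using Fin.lastCases with
  | last => rw [yIdx_last] at hi; exact (Sum.inr.inj hi).symm
  | cast i => simp [yIdx_castSucc] at hi

theorem tailProd_eq_of_slice (hn : 2 ≤ n) (hK : 2 ≤ K) {x x₀ : GVIndex n K → ℂ}
    (hx : ∀ c ∉ Set.range (yIdx hn hK), x c = x₀ c) (k : ℕ) :
    tailProd (gvSeq x) k = tailProd (gvSeq x₀) k := by
  refine tailProd_congr (fun k hk => ?_) k
  funext e
  by_cases h : k ∈ Set.Icc 2 K
  · rw [gvSeq_of_mem _ h, gvSeq_of_mem _ h]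
    refine hx _ fun hmem => ?_
    have := congrArg (fun e => (e.1 : ℕ)) (inr_mem_range_yIdx hn hK hmem)
    simp only at this
    omega
  · have h1 : k ≠ 1 := by omega
    simp [gvSeq, h, h1]

/-- The matrix `Z_2` with its first entry replaced by `0`. -/
def reducedEntry (hn : 2 ≤ n) (x : GVIndex n K → ℂ) (k i : Fin n) : ℂ :=
  if k = ⟨0, by omega⟩ ∧ i = ⟨0, by omega⟩ then 0 else gvSeq x 2 s(k, i)

theorem gvSeq_two_of_slice (hn : 2 ≤ n) (hK : 2 ≤ K) {x x₀ : GVIndex n K → ℂ}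
    (hx : ∀ c ∉ Set.range (yIdx hn hK), x c = x₀ c) (k i : Fin n) :
    gvSeq x 2 s(k, i) = reducedEntry hn x₀ k i +
      if k = ⟨0, by omega⟩ ∧ i = ⟨0, by omega⟩ then x (yIdx hn hK (Fin.last n)) else 0 := by
  unfold reducedEntry
  split_ifs with h
  · rw [h.1, h.2, zero_add, yIdx_last]
    exact gvSeq_of_mem _ _ _
  · have h2 : 2 ∈ Set.Icc 2 K := ⟨le_rfl, hK⟩
    rw [add_zero, gvSeq_of_mem _ h2, gvSeq_of_mem _ h2]
    refine hx _ fun hmem => h ?_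
    have := congrArg Prod.snd (inr_mem_range_yIdx hn hK hmem)
    simpa using this

/-- On a slice along the coordinates `y`, the defining polynomials are affine in
`(y_0, …, y_{n-1}, y_0 y_n)`. -/
theorem exists_gvPoly_slice (hn : 2 ≤ n) (hK : 2 ≤ K) (x₀ : GVIndex n K → ℂ) :
    ∃ (A : Fin n → Fin n → ℂ) (d e : Fin n → ℂ), ∀ x : GVIndex n K → ℂ,
      (∀ c ∉ Set.range (yIdx hn hK), x c = x₀ c) → ∀ j, gvPoly n K x j =
        ∑ k, x (Sum.inl k) * A k j +
          x (Sum.inl ⟨0, by omega⟩) * x (yIdx hn hK (Fin.last n)) * d j + e j := by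
  let B : Fin n ⊕ Fin n → Fin n → ℂ := fun b j =>
    tailProd (gvSeq x₀) (K - 2) b (if Even K then Sum.inr j else Sum.inl j)
  refine ⟨fun k j => B (Sum.inl k) j + ∑ i, reducedEntry hn x₀ k i * B (Sum.inr i) j,
    fun j => B (Sum.inr ⟨0, by omega⟩) j, fun j => ∑ i, lastVec n i * B (Sum.inr i) j,
    fun x hx j => ?_⟩
  rw [gvPoly_eq_sum hK]
  simp only [tailProd_eq_of_slice hn hK hx, gvSeq_two_of_slice hn hK hx]
  change ∑ i, x (Sum.inl i) * B (Sum.inl i) j + ∑ i, (_ + lastVec n i) * B (Sum.inr i) j = _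
  have h1 : ∀ i, ∑ k, x (Sum.inl k) * (reducedEntry hn x₀ k i +
      if k = ⟨0, by omega⟩ ∧ i = ⟨0, by omega⟩ then x (yIdx hn hK (Fin.last n)) else 0) =
      ∑ k, x (Sum.inl k) * reducedEntry hn x₀ k i + if i = ⟨0, by omega⟩ then
        x (Sum.inl ⟨0, by omega⟩) * x (yIdx hn hK (Fin.last n)) else 0 := by
    intro i
    simp only [mul_add, Finset.sum_add_distrib]
    congr 1
    by_cases hi : i = ⟨0, by omega⟩ <;> simp [hi]
  simp only [h1]
  simp only [add_mul, Finset.sum_add_distrib, mul_add, ite_mul, zero_mul, Finset.sum_ite_eq',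
    Finset.mem_univ, if_true, Finset.mul_sum, Finset.sum_mul]
  rw [Finset.sum_comm (f := fun k i => x (Sum.inl k) * (reducedEntry hn x₀ k i * B (Sum.inr i) j))]
  simp only [mul_assoc]
  ring

theorem fderiv_apply_eq_of_line {ι : Type} [Fintype ι] {p : (ι → ℂ) → ℂ} {x v : ι → ℂ} {r : ℂ}
    (hp : DifferentiableAt ℂ p x) (h : ∀ t : ℂ, p (x + t • v) = p x + t * r) :
    fderiv ℂ p x v = r := by
  rw [← hp.lineDeriv_eq_fderiv]
  refine HasLineDerivAt.lineDeriv ?_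
  unfold HasLineDerivAt
  simp only [h]
  simpa using ((hasDerivAt_id (0 : ℂ)).mul_const r).const_add (p x)

theorem exists_flow_fieldV (hn : 2 ≤ n) (hK : 2 ≤ K) (x₀ : GVIndex n K → ℂ) :
    ∃ φ : ℂ → GVIndex n K → ℂ, φ 0 = x₀ ∧ ∀ t, HasDerivAt φ (fieldV hn hK (φ t)) t := by
  obtain ⟨A, d, e, hA⟩ := exists_gvPoly_slice hn hK x₀
  have hslice : ∀ x : GVIndex n K → ℂ, (∀ c ∉ Set.range (yIdx hn hK), x c = x₀ c) →
      ∀ (j : Fin (n + 1)) (t : ℂ), ∀ c ∉ Set.range (yIdx hn hK),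
        (x + t • (Pi.single (yIdx hn hK j) 1 : GVIndex n K → ℂ)) c = x₀ c := by
    intro x hx j t c hc
    have hne : c ≠ yIdx hn hK j := fun h => hc ⟨j, h.symm⟩
    simp [Pi.single_eq_of_ne hne, hx c hc]
  refine exists_flow_jacobianField (yIdx_injective hn hK) ⟨0, by omega⟩ x₀ A d
    (fun x hx i k => ?_) fun x hx i => ?_
  · refine fderiv_apply_eq_of_line (differentiable_gvPoly i x) fun t => ?_
    rw [hA _ (hslice x hx _ t), hA x hx]
    simp only [yIdx_castSucc, yIdx_last, Pi.add_apply, Pi.smul_apply, smul_eq_mul, Pi.single_apply,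
      Sum.inl.injEq, reduceCtorEq, if_false, mul_zero, add_zero, add_mul, Finset.sum_add_distrib,
      mul_ite, mul_one, ite_mul, zero_mul, Finset.sum_ite_eq', Finset.mem_univ, if_true]
    by_cases hk : (⟨0, by omega⟩ : Fin n) = k
    · rw [if_pos hk, if_pos hk.symm]
      ring
    · rw [if_neg hk, if_neg (Ne.symm hk)]
      ring
  · refine fderiv_apply_eq_of_line (differentiable_gvPoly i x) fun t => ?_
    rw [hA _ (hslice x hx _ t), hA x hx]
    simp only [yIdx_castSucc, yIdx_last, Pi.add_apply, Pi.smul_apply, smul_eq_mul, Pi.single_apply,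
      reduceCtorEq, if_false, mul_zero, add_zero, mul_one, if_true]
    ring

end GVSlices

/-! ### The complete fields on the Gromov–Vaserstein varieties -/

section GVFields

open Matrix

variable {n K : ℕ}

theorem mem_gvVariety_of_flow {a : Fin n → ℂ} {W : (GVIndex n K → ℂ) → GVIndex n K → ℂ}
    (hW : ∀ x j, fderiv ℂ (fun y => gvPoly n K y j) x (W x) = 0) {φ : ℂ → GVIndex n K → ℂ}
    (h0 : φ 0 ∈ gvVariety n K a) (hφ : ∀ t, HasDerivAt φ (W (φ t)) t) (t : ℂ) :
    φ t ∈ gvVariety n K a := by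
  rw [← show gvPoly n K (φ 0) = a from h0]
  exact funext fun j => apply_eq_of_fderiv_eq_zero (differentiable_gvPoly j) (fun x => hW x j) hφ t

theorem fieldV_apply_of_notMem (hn : 2 ≤ n) (hK : 2 ≤ K) (x : GVIndex n K → ℂ) {c : GVIndex n K}
    (hc : c ∉ Set.range (yIdx hn hK)) : fieldV hn hK x c = 0 :=
  jacobianField_apply_of_notMem _ x hc

/-- The restriction of `V` to the variety. -/
noncomputable def holoFieldV (hn : 2 ≤ n) (hK : 2 ≤ K) (a : Fin n → ℂ) : HoloVF (gvVariety n K a) :=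
  HoloVF.ofFlow _ (fieldV hn hK) (fun c x => analyticAt_jacobianField isPolyFun_gvPoly _ c x)
    fun x hx => by
      obtain ⟨φ, h0, hφ⟩ := exists_flow_fieldV hn hK x
      exact ⟨φ, h0, mem_gvVariety_of_flow (fun x j => fderiv_jacobianField_eq_zero _ _ x j)
        (by rwa [h0]) hφ, hφ⟩

/-- The half of `P^{k-1}` that is multiplied with `Z_k`. -/
def activeHalf (k : ℕ) (v : Fin n ⊕ Fin n → ℂ) : Fin n → ℂ := fun i =>
  if Even k then v (Sum.inl i) else v (Sum.inr i)

/-- The coordinate `z_{k,ij}`. -/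
def zCoord {k : ℕ} (hk : k ∈ Set.Icc 2 K) (i j : Fin n) : GVIndex n K := Sum.inr (⟨k, hk⟩, s(i, j))

/-- The field `f_q² ∂/∂z_{k,pp} − f_p f_q ∂/∂z_{k,pq} + f_p² ∂/∂z_{k,qq}`, where `f` is the half of
`P^{k-1}` that is multiplied with `Z_k`. -/
noncomputable def pencilField {k : ℕ} (hk : k + 1 ∈ Set.Icc 2 K) (p q : Fin n)
    (x : GVIndex n K → ℂ) : GVIndex n K → ℂ :=
  let f := activeHalf (k + 1) (gvMap (gvSeq x) k)
  f q ^ 2 • Pi.single (zCoord hk p p) 1 - (f p * f q) • Pi.single (zCoord hk p q) 1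
    + f p ^ 2 • Pi.single (zCoord hk q q) 1

theorem pencilField_one (hk : 1 + 1 ∈ Set.Icc 2 K) (p q : Fin n) (x : GVIndex n K → ℂ) :
    pencilField hk p q x = x (Sum.inl q) ^ 2 • Pi.single (zCoord hk p p) 1
      - (x (Sum.inl p) * x (Sum.inl q)) • Pi.single (zCoord hk p q) 1
      + x (Sum.inl p) ^ 2 • Pi.single (zCoord hk q q) 1 := by
  rw [pencilField, gvMap_gvSeq_one]
  simp [activeHalf]

theorem pencilField_two (hk : 2 + 1 ∈ Set.Icc 2 K) (p q : Fin n) (x : GVIndex n K → ℂ) :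
    pencilField hk p q x =
      gvMap (gvSeq x) 2 (Sum.inr q) ^ 2 • Pi.single (zCoord hk p p) 1
      - (gvMap (gvSeq x) 2 (Sum.inr p) * gvMap (gvSeq x) 2 (Sum.inr q)) •
        Pi.single (zCoord hk p q) 1
      + gvMap (gvSeq x) 2 (Sum.inr p) ^ 2 • Pi.single (zCoord hk q q) 1 := by
  simp [pencilField, activeHalf, show ¬ Even 3 by decide]

theorem pencilField_apply_of_ne {k : ℕ} (hk : k + 1 ∈ Set.Icc 2 K) (p q : Fin n)
    (x : GVIndex n K → ℂ) {c : GVIndex n K} (h1 : c ≠ zCoord hk p p) (h2 : c ≠ zCoord hk p q)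
    (h3 : c ≠ zCoord hk q q) : pencilField hk p q x c = 0 := by
  simp [pencilField, Pi.single_eq_of_ne h1, Pi.single_eq_of_ne h2, Pi.single_eq_of_ne h3]

/-- Read as a symmetric matrix, the field is `u uᵀ` with `u = f_q e_p - f_p e_q`. The single
coordinate `z_{pq}` fills both off-diagonal entries. -/
theorem pencilField_apply {k : ℕ} (hk : k + 1 ∈ Set.Icc 2 K) {p q : Fin n} (hpq : p ≠ q)
    (x : GVIndex n K → ℂ) (i j : Fin n) :
    pencilField hk p q x (zCoord hk i j) =
      ((if i = p then activeHalf (k + 1) (gvMap (gvSeq x) k) q else 0) -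
        (if i = q then activeHalf (k + 1) (gvMap (gvSeq x) k) p else 0)) *
      ((if j = p then activeHalf (k + 1) (gvMap (gvSeq x) k) q else 0) -
        (if j = q then activeHalf (k + 1) (gvMap (gvSeq x) k) p else 0)) := by
  simp only [pencilField, zCoord, Pi.add_apply, Pi.sub_apply, Pi.smul_apply, smul_eq_mul,
    Pi.single_apply, Sum.inr.injEq, Prod.mk.injEq, true_and, Sym2.eq_iff]
  by_cases hip : i = p
  · subst hip
    by_cases hjp : j = i
    · subst hjp
      simp [hpq]
      ring
    · by_cases hjq : j = q
      · subst hjq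
        simp [hpq, hpq.symm]
        ring
      · simp [hpq, hjp, hjq]
  · by_cases hiq : i = q
    · subst hiq
      by_cases hjp : j = p
      · subst hjp
        simp [hpq, hpq.symm]
      · by_cases hjq : j = i
        · subst hjq
          simp [hpq.symm]
          ring
        · simp [hip, hjp, hjq]
    · simp [hip, hiq]

theorem gvSeq_congr {x x' : GVIndex n K → ℂ} {l : ℕ} (h1 : ∀ j, x (Sum.inl j) = x' (Sum.inl j))
    (h2 : ∀ (h : l ∈ Set.Icc 2 K) (i j : Fin n), x (zCoord h i j) = x' (zCoord h i j)) :
    gvSeq x l = gvSeq x' l := by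
  funext e
  induction e using Sym2.inductionOn with
  | hf i j =>
    by_cases h : l ∈ Set.Icc 2 K
    · rw [gvSeq_of_mem _ h, gvSeq_of_mem _ h]
      exact h2 h i j
    · simp [gvSeq, h, h1]

theorem gvMap_congr_of_le {Z Z' : ℕ → Sym2 (Fin n) → ℂ} {k : ℕ} (h : ∀ l ≤ k, Z l = Z' l) :
    gvMap Z k = gvMap Z' k := by
  induction k with
  | zero => rfl
  | succ k ih => rw [gvMap, gvMap, ih fun l hl => h l (by omega), h _ le_rfl]

theorem gvMap_congr_of_lt {Z Z' : ℕ → Sym2 (Fin n) → ℂ} {k : ℕ} (h0 : gvMap Z k = gvMap Z' k)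
    {m : ℕ} (hkm : k ≤ m) (h : ∀ l, k < l → l ≤ m → Z l = Z' l) : gvMap Z m = gvMap Z' m := by
  induction m, hkm using Nat.le_induction with
  | base => exact h0
  | succ m hkm ih =>
    rw [gvMap, gvMap, ih fun l h1 h2 => h l h1 (by omega), h _ (by omega) le_rfl]

/-! ### Straight-line flows of the pencil fields and their invariants. -/

section PencilFlow

variable {k : ℕ} (hk : k + 1 ∈ Set.Icc 2 K) {p q : Fin n} (x : GVIndex n K → ℂ) (t : ℂ)

theorem gvSeq_add_smul_pencilField {l : ℕ} (hl : l ≠ k + 1) :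
    gvSeq (x + t • pencilField hk p q x) l = gvSeq x l := by
  refine gvSeq_congr (fun j => ?_) fun h i j => ?_
  · rw [Pi.add_apply, Pi.smul_apply, pencilField_apply_of_ne] <;> simp [zCoord]
  · rw [Pi.add_apply, Pi.smul_apply, pencilField_apply_of_ne] <;> simp [zCoord, hl]

theorem gvMap_add_smul_pencilField :
    gvMap (gvSeq (x + t • pencilField hk p q x)) k = gvMap (gvSeq x) k :=
  gvMap_congr_of_le fun l hl => gvSeq_add_smul_pencilField hk x t (by omega)

theorem pencilField_add_smul :
    pencilField hk p q (x + t • pencilField hk p q x) = pencilField hk p q x := by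
  have h : ∀ y : GVIndex n K → ℂ, gvMap (gvSeq y) k = gvMap (gvSeq x) k →
      pencilField hk p q y = pencilField hk p q x := fun y hy => by
    simp only [pencilField, hy]
  exact h _ (gvMap_add_smul_pencilField hk x t)

/-- The change in `f Z_{k+1}` is `t (f · u) uᵀ`, and `f · u = f_p f_q - f_q f_p = 0`. -/
theorem gvMap_succ_add_smul_pencilField (hpq : p ≠ q) :
    gvMap (gvSeq (x + t • pencilField hk p q x)) (k + 1) = gvMap (gvSeq x) (k + 1) := by
  have hsum : ∀ j, ∑ i, activeHalf (k + 1) (gvMap (gvSeq x) k) i *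
      gvSeq (x + t • pencilField hk p q x) (k + 1) s(i, j) =
      ∑ i, activeHalf (k + 1) (gvMap (gvSeq x) k) i * gvSeq x (k + 1) s(i, j) := by
    intro j
    have h : ∀ i, gvSeq (x + t • pencilField hk p q x) (k + 1) s(i, j) =
        gvSeq x (k + 1) s(i, j) + t * pencilField hk p q x (zCoord hk i j) := by
      intro i
      rw [gvSeq_of_mem _ hk, gvSeq_of_mem _ hk]
      rfl
    simp only [h, pencilField_apply hk hpq, mul_add, Finset.sum_add_distrib]
    rw [add_eq_left]
    simp only [← mul_assoc]
    rw [← Finset.sum_mul]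
    refine mul_eq_zero_of_left ?_ _
    simp only [mul_comm _ t, mul_assoc, mul_sub, mul_ite, mul_zero,
      Finset.sum_sub_distrib, Finset.sum_ite_eq', Finset.mem_univ, if_true]
    ring
  by_cases he : Even (k + 1)
  · simp only [activeHalf, if_pos he] at hsum
    rw [gvMap_succ_of_even _ he, gvMap_succ_of_even _ he, gvMap_add_smul_pencilField]
    simp only [hsum]
  · simp only [activeHalf, if_neg he] at hsum
    rw [gvMap_succ_of_odd _ he, gvMap_succ_of_odd _ he, gvMap_add_smul_pencilField]
    simp only [hsum]

theorem gvPoly_add_smul_pencilField (hpq : p ≠ q) :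
    gvPoly n K (x + t • pencilField hk p q x) = gvPoly n K x := by
  unfold gvPoly
  rw [gvMap_congr_of_lt (gvMap_succ_add_smul_pencilField hk x t hpq) hk.2 fun l h1 _ =>
    gvSeq_add_smul_pencilField hk x t (by omega)]

end PencilFlow

theorem isPolyFun_pencilField {k : ℕ} (hk : k + 1 ∈ Set.Icc 2 K) (p q : Fin n) (c : GVIndex n K) :
    IsPolyFun fun x => pencilField hk p q x c := by
  have hf : ∀ i, IsPolyFun fun x : GVIndex n K → ℂ =>
      activeHalf (k + 1) (gvMap (gvSeq x) k) i := by
    intro i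
    unfold activeHalf
    split_ifs
    · exact isPolyFun_gvMap _ _
    · exact isPolyFun_gvMap _ _
  simp only [pencilField, Pi.add_apply, Pi.sub_apply, Pi.smul_apply, smul_eq_mul]
  simp only [sq, sub_eq_add_neg, ← mul_neg]
  exact ((((hf q).mul (hf q)).mul (.const _)).add (((hf p).mul (hf q)).mul (.const _))).add
    (((hf p).mul (hf p)).mul (.const _))

theorem add_smul_pencilField_mem {k : ℕ} (hk : k + 1 ∈ Set.Icc 2 K) {p q : Fin n} (hpq : p ≠ q)
    {a : Fin n → ℂ} {x : GVIndex n K → ℂ} (hx : x ∈ gvVariety n K a) (t : ℂ) :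
    x + t • pencilField hk p q x ∈ gvVariety n K a :=
  (gvPoly_add_smul_pencilField hk x t hpq).trans hx

theorem hasDerivAt_add_smul {ι : Type} [Fintype ι] (x v : ι → ℂ) (t : ℂ) :
    HasDerivAt (fun s : ℂ => x + s • v) v t := by
  simpa using ((hasDerivAt_id t).smul_const v).const_add x

/-- The restriction of `pencilField` to the variety. -/
noncomputable def holoPencilField {k : ℕ} (hk : k + 1 ∈ Set.Icc 2 K) {p q : Fin n} (hpq : p ≠ q)
    (a : Fin n → ℂ) : HoloVF (gvVariety n K a) :=
  HoloVF.ofFlow _ (pencilField hk p q) (fun c x => (isPolyFun_pencilField hk p q c).analyticAt x)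
    fun x hx => ⟨fun t => x + t • pencilField hk p q x, by simp, add_smul_pencilField_mem hk hpq hx,
      fun t => by
        rw [pencilField_add_smul]
        exact hasDerivAt_add_smul _ _ _⟩

theorem holoPencilField_flow {k : ℕ} (hk : k + 1 ∈ Set.Icc 2 K) {p q : Fin n} (hpq : p ≠ q)
    (a : Fin n → ℂ) (c : GVIndex n K) (x : gvVariety n K a) :
    ∃ φ : ℂ → gvVariety n K a, φ 0 = x ∧
      HasDerivAt (fun t => (φ t : GVIndex n K → ℂ)) ((holoPencilField hk hpq a).toFun x) 0 ∧
      ∀ t, (holoPencilField hk hpq a).toFun (φ t) c = (holoPencilField hk hpq a).toFun x c :=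
  ⟨fun t => ⟨x + t • pencilField hk p q x, add_smul_pencilField_mem hk hpq x.2 t⟩,
    Subtype.ext (by simp), hasDerivAt_add_smul _ _ _, fun t =>
      congrFun (pencilField_add_smul hk (x : GVIndex n K → ℂ) t) c⟩

theorem holoFieldV_isComplete (hn : 2 ≤ n) (hK : 2 ≤ K) (a : Fin n → ℂ) :
    (holoFieldV hn hK a).IsComplete := by
  unfold holoFieldV
  apply HoloVF.isComplete_ofFlow

theorem holoPencilField_isComplete {k : ℕ} (hk : k + 1 ∈ Set.Icc 2 K) {p q : Fin n} (hpq : p ≠ q)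
    (a : Fin n → ℂ) : (holoPencilField hk hpq a).IsComplete := by
  unfold holoPencilField
  apply HoloVF.isComplete_ofFlow

theorem pencilField_apply_fst {k : ℕ} (hk : k + 1 ∈ Set.Icc 2 K) {p q : Fin n} (hpq : p ≠ q)
    (x : GVIndex n K → ℂ) : pencilField hk p q x (zCoord hk p p) =
      activeHalf (k + 1) (gvMap (gvSeq x) k) q ^ 2 := by
  rw [pencilField_apply hk hpq]
  simp [hpq]
  ring

theorem pencilField_apply_snd {k : ℕ} (hk : k + 1 ∈ Set.Icc 2 K) {p q : Fin n} (hpq : p ≠ q)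
    (x : GVIndex n K → ℂ) : pencilField hk p q x (zCoord hk q q) =
      activeHalf (k + 1) (gvMap (gvSeq x) k) p ^ 2 := by
  rw [pencilField_apply hk hpq]
  simp [hpq.symm]
  ring

/-- The pencil field moves only coordinates outside `y`, and `V` only those in `y`, so each
coordinate is killed by one of them. The edge function is `z_{k+1,qq}` or `z_{k+1,pp}`, whose
derivatives `f_p²` and `f_q²` are constant along the pencil flow; `x` ensures that one of them is
not identically zero. -/
theorem exists_compatible_pair (hn : 2 ≤ n) (hK : 2 ≤ K) (a : Fin n → ℂ) {k : ℕ}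
    (hk : k + 1 ∈ Set.Icc 2 K) {p q : Fin n} (hpq : p ≠ q)
    (h1 : zCoord hk p p ∉ Set.range (yIdx hn hK)) (h2 : zCoord hk p q ∉ Set.range (yIdx hn hK))
    (h3 : zCoord hk q q ∉ Set.range (yIdx hn hK)) {x : GVIndex n K → ℂ}
    (hx : x ∈ gvVariety n K a) (hpt : activeHalf (k + 1) (gvMap (gvSeq x) k) p ≠ 0 ∨
      activeHalf (k + 1) (gvMap (gvSeq x) k) q ≠ 0) :
    ∃ θ : Fin 2 → HoloVF (gvVariety n K a), (∀ x, (θ 0).toFun x = fieldV hn hK x) ∧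
      (∀ x, (θ 1).toFun x = pencilField hk p q x) ∧ IsCompatibleTuple θ := by
  obtain ⟨J, hJ⟩ := exists_gvVariety_eq_zeroLocus (n := n) (K := K) a
  obtain ⟨c, hc, hc'⟩ : ∃ c, c ∉ Set.range (yIdx hn hK) ∧ pencilField hk p q x c ≠ 0 := by
    rcases hpt with h | h
    · exact ⟨_, h3, by rw [pencilField_apply_snd hk hpq]; exact pow_ne_zero _ h⟩
    · exact ⟨_, h1, by rw [pencilField_apply_fst hk hpq]; exact pow_ne_zero _ h⟩
  have hne : holoFieldV hn hK a ≠ holoPencilField hk hpq a := by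
    intro h
    have := congrArg (fun θ : HoloVF (gvVariety n K a) => θ.toFun ⟨x, hx⟩ c) h
    exact hc' (this.symm.trans (fieldV_apply_of_notMem hn hK x hc))
  refine ⟨![holoFieldV hn hK a, holoPencilField hk hpq a], fun _ => rfl, fun _ => rfl, ?_⟩
  refine isCompatibleTuple_of_coordFun J hJ ⟨x, hx⟩ (fun i => ?_) (fun i j hij => ?_) (fun c' => ?_)
    fun i hi => ?_
  · fin_cases i
    · exact holoFieldV_isComplete hn hK a
    · exact holoPencilField_isComplete hk hpq a
  · fin_cases i <;> fin_cases j
    · rfl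
    · exact absurd hij hne
    · exact absurd hij hne.symm
    · rfl
  · by_cases hmem : c' ∈ Set.range (yIdx hn hK)
    · exact ⟨1, fun y => pencilField_apply_of_ne hk p q y (fun h => h1 (h ▸ hmem))
        (fun h => h2 (h ▸ hmem)) (fun h => h3 (h ▸ hmem))⟩
    · exact ⟨0, fun y => fieldV_apply_of_notMem hn hK y hmem⟩
  · fin_cases i
    · exact absurd rfl hi
    exact ⟨c, fun y => fieldV_apply_of_notMem hn hK y hc, ⟨⟨x, hx⟩, hc'⟩,
      holoPencilField_flow hk hpq a c⟩

end GVFields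

/-! ### Points of the varieties -/

section GVPoints

open Matrix

variable {n K : ℕ}

/-- The symmetric matrix with `i`-th row and column `b` and zeros elsewhere. -/
def crossMatrix (i : Fin n) (b : Fin n → ℂ) : Sym2 (Fin n) → ℂ :=
  Sym2.lift ⟨fun k l => if k = i then b l else if l = i then b k else 0, by
    intro k l
    by_cases hk : k = i <;> by_cases hl : l = i <;> simp [hk, hl]⟩

theorem sum_single_mul_crossMatrix (i : Fin n) (b : Fin n → ℂ) (j : Fin n) :
    ∑ k, (Pi.single i 1 : Fin n → ℂ) k * crossMatrix i b s(k, j) = b j := by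
  rw [Finset.sum_eq_single i]
  · simp [crossMatrix]
  · intro k _ hk
    simp [Pi.single_eq_of_ne hk]
  · simp

theorem gvMap_eq_of_eq_zero {Z : ℕ → Sym2 (Fin n) → ℂ} {k m : ℕ} (hkm : k ≤ m)
    (h : ∀ l, k < l → l ≤ m → Z l = 0) : gvMap Z m = gvMap Z k := by
  induction m, hkm using Nat.le_induction with
  | base => rfl
  | succ m hkm ih =>
    have h0 : symMatrix (0 : Sym2 (Fin n) → ℂ) = 0 := by
      ext
      simp [symMatrix]
    rw [gvMap, ih fun l h1 h2 => h l h1 (by omega), h _ (by omega) le_rfl, elemMatrix, h0]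
    simp

/-- Supplies nonemptiness together with control over `z` and the second half of `P²`, hence points
where the fields do not vanish. -/
theorem exists_mem_gvVariety (hK : 2 ≤ K) (a : Fin n → ℂ) (i r : Fin n) :
    ∃ x ∈ gvVariety n K a, (∀ j, x (Sum.inl j) = (Pi.single i 1 : Fin n → ℂ) j) ∧
      ∀ j, gvMap (gvSeq x) 2 (Sum.inr j) = if Even K then a j else (Pi.single r 1 : Fin n → ℂ) j := by
  let b : Fin n → ℂ := fun j => if Even K then a j else (Pi.single r 1 : Fin n → ℂ) j
  -- Row `i` of `Z_2` brings the second half of `P²` to `b`. For even `K` this is already `a`; for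
  -- odd `K` it is `e_r`, and row `r` of `Z_3` turns the first half from `e_i` into `a`. All later
  -- matrices are zero.
  let Z : ℕ → Sym2 (Fin n) → ℂ := fun k => if k = 2 then crossMatrix i (b - lastVec n) else
    if k = 3 ∧ ¬ Even K then crossMatrix r (a - Pi.single i 1) else 0
  let x : GVIndex n K → ℂ := Sum.elim (Pi.single i 1) fun e => Z e.1 e.2
  have hxZ : ∀ k, k ∈ Set.Icc 2 K → gvSeq x k = Z k := by
    intro k hk
    funext e
    rw [gvSeq_of_mem x hk]
    rfl
  have hP2 : gvMap (gvSeq x) 2 = Sum.elim (Pi.single i 1) b := by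
    rw [gvMap_succ_of_even _ (by decide), gvMap_gvSeq_one, hxZ 2 ⟨le_rfl, hK⟩]
    refine congrArg₂ Sum.elim rfl (funext fun j => ?_)
    have := sum_single_mul_crossMatrix i (b - lastVec n) j
    simp only [Sum.elim_inl, Sum.elim_inr, x, Z, if_true, this]
    simp
  refine ⟨x, ?_, fun j => rfl, fun j => by rw [hP2]; rfl⟩
  change gvPoly n K x = a
  funext j
  unfold gvPoly
  by_cases hE : Even K
  · rw [if_pos hE, gvMap_eq_of_eq_zero hK, hP2]
    · simp [b, hE]
    · intro l h1 h2
      rw [hxZ l ⟨h1.le, h2⟩]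
      simp [Z, h1.ne', hE]
  · have hK3 : 3 ≤ K := by
      rcases hK.lt_or_eq with h | h
      · exact h
      · exact absurd (h ▸ even_two) hE
    rw [if_neg hE, gvMap_eq_of_eq_zero hK3, gvMap_succ_of_odd _ (by decide), hP2,
      hxZ 3 ⟨by omega, hK3⟩]
    · have := sum_single_mul_crossMatrix r (a - Pi.single i 1) j
      have hb : b = Pi.single r 1 := by
        funext j
        simp [b, hE]
      simp only [Sum.elim_inl, Sum.elim_inr, Z, hb, hE, not_false_eq_true, and_true, if_true]
      norm_num [this]
    · intro l h1 h2
      rw [hxZ l ⟨by omega, h2⟩]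
      simp [Z, h1.ne', show l ≠ 2 by omega]

end GVPoints

/-! ### The variety for `n = K = 2` -/

section GVTwoTwo

variable (hn : 2 ≤ 2) (hK : 2 ≤ 2)

theorem gvPoly_two_two (x : GVIndex 2 2 → ℂ) (j : Fin 2) :
    gvPoly 2 2 x j = x (Sum.inl 0) * x (Sum.inr (⟨2, le_rfl, le_rfl⟩, s(0, j))) +
      x (Sum.inl 1) * x (Sum.inr (⟨2, le_rfl, le_rfl⟩, s(1, j))) + lastVec 2 j := by
  rw [gvPoly, if_pos even_two, gvMap_succ_of_even _ (by decide), gvMap_gvSeq_one]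
  simp [gvSeq_of_mem x (k := 2) ⟨le_rfl, le_rfl⟩]

theorem gvPoly_two_two_zero (x : GVIndex 2 2 → ℂ) : gvPoly 2 2 x 0 =
    x (idxW1 hn hK) * x (idxZ2 hn) + x (idxW2 hn hK) * x (idxZ3 hn) + lastVec 2 0 := by
  rw [gvPoly_two_two, Sym2.eq_swap (a := (1 : Fin 2)), mul_comm, mul_comm (x (Sum.inl 1))]
  rfl

theorem gvPoly_two_two_one (x : GVIndex 2 2 → ℂ) : gvPoly 2 2 x 1 =
    x (idxW2 hn hK) * x (idxZ2 hn) + x (idxW3 hn hK) * x (idxZ3 hn) + lastVec 2 1 := by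
  rw [gvPoly_two_two, mul_comm, mul_comm (x (Sum.inl 1))]
  rfl

theorem mem_gvVariety_two_two (a : Fin 2 → ℂ) (x : GVIndex 2 2 → ℂ) :
    x ∈ gvVariety 2 2 a ↔
      x (idxW1 hn hK) * x (idxZ2 hn) + x (idxW2 hn hK) * x (idxZ3 hn) = (a - lastVec 2) 0 ∧
      x (idxW2 hn hK) * x (idxZ2 hn) + x (idxW3 hn hK) * x (idxZ3 hn) = (a - lastVec 2) 1 := by
  have h : x ∈ gvVariety 2 2 a ↔ gvPoly 2 2 x = a := Iff.rfl
  rw [h, funext_iff, Fin.forall_fin_two, gvPoly_two_two_zero hn hK, gvPoly_two_two_one hn hK,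
    Pi.sub_apply, Pi.sub_apply, eq_sub_iff_add_eq, eq_sub_iff_add_eq]

theorem fderiv_gvPoly_two_two (x v : GVIndex 2 2 → ℂ) (j : Fin 2) :
    fderiv ℂ (fun y => gvPoly 2 2 y j) x v =
      x (Sum.inl 0) * v (Sum.inr (⟨2, le_rfl, le_rfl⟩, s(0, j))) +
      v (Sum.inl 0) * x (Sum.inr (⟨2, le_rfl, le_rfl⟩, s(0, j))) +
      (x (Sum.inl 1) * v (Sum.inr (⟨2, le_rfl, le_rfl⟩, s(1, j))) +
      v (Sum.inl 1) * x (Sum.inr (⟨2, le_rfl, le_rfl⟩, s(1, j)))) := by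
  have hc : ∀ c : GVIndex 2 2, HasFDerivAt (fun y : GVIndex 2 2 → ℂ => y c)
      (ContinuousLinearMap.proj (R := ℂ) (φ := fun _ : GVIndex 2 2 => ℂ) c) x := fun c =>
    (ContinuousLinearMap.proj (R := ℂ) (φ := fun _ : GVIndex 2 2 => ℂ) c).hasFDerivAt
  simp only [gvPoly_two_two]
  refine (DFunLike.congr_fun ((((hc (Sum.inl 0)).mul (hc _)).add
    ((hc (Sum.inl 1)).mul (hc _))).add_const _).fderiv v).trans ?_
  simp
  ring

/-- If `b = 0`, the origin lies on the variety, and the differential of the bilinear equations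
vanishes there. -/
theorem sub_lastVec_ne_zero_of_gvSmooth {a : Fin 2 → ℂ} (h : GVSmooth 2 2 a) :
    a - lastVec 2 ≠ 0 := by
  intro ha
  have h0 : (0 : GVIndex 2 2 → ℂ) ∈ gvVariety 2 2 a := by
    rw [mem_gvVariety_two_two le_rfl le_rfl, ha]
    simp
  obtain ⟨v, hv⟩ := h 0 h0 (fun _ => 1)
  have h1 : fderiv ℂ (gvPoly 2 2) 0 v 0 = fderiv ℂ (fun y => gvPoly 2 2 y 0) 0 v := by
    rw [fderiv_pi fun j => differentiable_gvPoly j 0]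
    rfl
  rw [hv, fderiv_gvPoly_two_two] at h1
  simp at h1

theorem fderiv_gvPoly_two_two_fieldV1 (x : GVIndex 2 2 → ℂ) (j : Fin 2) :
    fderiv ℂ (fun y => gvPoly 2 2 y j) x (fieldV1 hn hK x) = 0 := by
  rw [fderiv_gvPoly_two_two]
  fin_cases j
  · simp [fieldV1, coordVec, idxZ2, idxZ3, idxW1, idxW2, idxW3, zIdx, wIdx,
      Sym2.eq_swap (a := (1 : Fin 2)) (b := 0)]
    ring
  · simp [fieldV1, coordVec, idxZ2, idxZ3, idxW1, idxW2, idxW3, zIdx, wIdx]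
    ring

theorem fderiv_gvPoly_two_two_fieldV3 (x : GVIndex 2 2 → ℂ) (j : Fin 2) :
    fderiv ℂ (fun y => gvPoly 2 2 y j) x (fieldV3 hn hK x) = 0 := by
  rw [fderiv_gvPoly_two_two]
  fin_cases j
  · simp [fieldV3, coordVec, idxZ2, idxZ3, idxW1, idxW2, idxW3, zIdx, wIdx,
      Sym2.eq_swap (a := (1 : Fin 2)) (b := 0)]
    ring
  · simp [fieldV3, coordVec, idxZ2, idxZ3, idxW1, idxW2, idxW3, zIdx, wIdx]
    ring

theorem exists_flow_fieldV1 (x₀ : GVIndex 2 2 → ℂ) :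
    ∃ φ : ℂ → GVIndex 2 2 → ℂ, φ 0 = x₀ ∧ ∀ t, HasDerivAt φ (fieldV1 hn hK (φ t)) t := by
  refine exists_linear_flow (u := idxZ2 hn) (w := idxW1 hn hK)
    (S := {idxZ2 hn, idxZ3 hn, idxW1 hn hK})
    (κ := (-x₀ (idxW3 hn hK)) • coordVec (idxZ2 hn) + x₀ (idxW2 hn hK) • coordVec (idxZ3 hn))
    (α := -x₀ (idxW2 hn hK) ^ 2) (β := x₀ (idxW3 hn hK)) ?_ ?_ (fun c hc => ?_) fun x hx => ?_
  · simp [idxZ2, idxW1, zIdx, wIdx]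
  · simp
  · simp only [Set.mem_insert_iff, Set.mem_singleton_iff, not_or] at hc
    simp [coordVec, Pi.single_eq_of_ne hc.1, Pi.single_eq_of_ne hc.2.1]
  · have h2 : x (idxW2 hn hK) = x₀ (idxW2 hn hK) := hx _ (by
      simp [idxZ2, idxZ3, idxW1, idxW2, zIdx, wIdx])
    have h3 : x (idxW3 hn hK) = x₀ (idxW3 hn hK) := hx _ (by
      simp [idxZ2, idxZ3, idxW1, idxW3, zIdx, wIdx])
    constructor
    · intro c hc
      simp only [fieldV1, coordVec, Pi.add_apply, Pi.smul_apply, smul_eq_mul,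
        Pi.single_eq_of_ne hc, h2, h3]
      ring
    · have e1 : idxW1 (K := 2) hn hK ≠ idxZ2 hn := by simp [idxZ2, idxW1, zIdx, wIdx]
      have e2 : idxW1 (K := 2) hn hK ≠ idxZ3 hn := by simp [idxZ3, idxW1, zIdx, wIdx]
      simp only [fieldV1, coordVec, Pi.add_apply, Pi.smul_apply, smul_eq_mul,
        Pi.single_eq_of_ne e1, Pi.single_eq_of_ne e2, Pi.single_eq_same, h2, h3]
      ring

/-- The integral curve of `V₃` through `x`. -/
noncomputable def flowV3 (x : GVIndex 2 2 → ℂ) (t : ℂ) : GVIndex 2 2 → ℂ :=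
  x + t • fieldV3 hn hK x + (t ^ 2 * (x (idxW1 hn hK) * x (idxZ3 hn) ^ 2)) • coordVec (idxW3 hn hK)

theorem flowV3_zero (x : GVIndex 2 2 → ℂ) : flowV3 hn hK x 0 = x := by
  simp [flowV3]

theorem flowV3_idxZ3 (x : GVIndex 2 2 → ℂ) (t : ℂ) :
    flowV3 hn hK x t (idxZ3 hn) = x (idxZ3 hn) := by
  simp [flowV3, fieldV3, coordVec, idxZ2, idxZ3, idxW2, idxW3, zIdx, wIdx]

theorem flowV3_idxW1 (x : GVIndex 2 2 → ℂ) (t : ℂ) :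
    flowV3 hn hK x t (idxW1 hn hK) = x (idxW1 hn hK) := by
  simp [flowV3, fieldV3, coordVec, idxZ2, idxW1, idxW2, idxW3, zIdx, wIdx]

/-- Along the curve `z₃` and `w₁` are fixed while `z₂` and `w₂` are affine in `t`. Hence `w₁z₂ -
w₂z₃` has slope `2 w₁z₃²`, which accounts for the term `t² w₁z₃²` in `w₃`. -/
theorem hasDerivAt_flowV3 (x : GVIndex 2 2 → ℂ) (t : ℂ) :
    HasDerivAt (flowV3 hn hK x) (fieldV3 hn hK (flowV3 hn hK x t)) t := by
  have h1 : HasDerivAt (flowV3 hn hK x) (fieldV3 hn hK x +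
      (2 * t * (x (idxW1 hn hK) * x (idxZ3 hn) ^ 2)) • coordVec (idxW3 hn hK)) t := by
    refine (hasDerivAt_add_smul x _ t).add ?_
    have := ((hasDerivAt_pow 2 t).mul_const
      (x (idxW1 hn hK) * x (idxZ3 hn) ^ 2)).smul_const (coordVec (idxW3 (n := 2) (K := 2) hn hK))
    simpa using this
  have hz : flowV3 hn hK x t (idxZ2 hn) = x (idxZ2 hn) + t * x (idxZ3 hn) ^ 2 := by
    simp [flowV3, fieldV3, coordVec, idxZ2, idxZ3, idxW2, idxW3, zIdx, wIdx]
  have hw : flowV3 hn hK x t (idxW2 hn hK) =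
      x (idxW2 hn hK) - t * (x (idxW1 hn hK) * x (idxZ3 hn)) := by
    simp [flowV3, fieldV3, coordVec, idxZ2, idxZ3, idxW1, idxW2, idxW3, zIdx, wIdx, sub_eq_add_neg]
  convert h1 using 1
  rw [fieldV3, flowV3_idxZ3, flowV3_idxW1, hz, hw, fieldV3]
  module

/-- The restriction of `V₁` to the variety. -/
noncomputable def holoFieldV1 (a : Fin 2 → ℂ) : HoloVF (gvVariety 2 2 a) :=
  HoloVF.ofFlow _ (fieldV1 hn hK) (fun c x => by
      refine IsPolyFun.analyticAt ?_ x
      simp only [fieldV1, Pi.add_apply, Pi.smul_apply, smul_eq_mul, sq]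
      exact ((((IsPolyFun.coord _).mul (.coord _)).neg.mul (.const _)).add
        (((IsPolyFun.coord _).mul (.coord _)).mul (.const _))).add
        ((((IsPolyFun.coord _).mul (.coord _)).sub ((IsPolyFun.coord _).mul (.coord _))).mul
          (.const _)))
    fun x hx => by
      obtain ⟨φ, h0, hφ⟩ := exists_flow_fieldV1 hn hK x
      exact ⟨φ, h0, mem_gvVariety_of_flow (fderiv_gvPoly_two_two_fieldV1 hn hK)
        (by rwa [h0]) hφ, hφ⟩

theorem flowV3_mem {a : Fin 2 → ℂ} {x : GVIndex 2 2 → ℂ} (hx : x ∈ gvVariety 2 2 a) (t : ℂ) :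
    flowV3 hn hK x t ∈ gvVariety 2 2 a :=
  mem_gvVariety_of_flow (fderiv_gvPoly_two_two_fieldV3 hn hK) (by rwa [flowV3_zero])
    (hasDerivAt_flowV3 hn hK x) t

/-- The restriction of `V₃` to the variety. -/
noncomputable def holoFieldV3 (a : Fin 2 → ℂ) : HoloVF (gvVariety 2 2 a) :=
  HoloVF.ofFlow _ (fieldV3 hn hK) (fun c x => by
      refine IsPolyFun.analyticAt ?_ x
      simp only [fieldV3, Pi.add_apply, Pi.sub_apply, Pi.smul_apply, smul_eq_mul, sq]
      exact ((((IsPolyFun.coord _).mul (.coord _)).mul (.const _)).sub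
        (((IsPolyFun.coord _).mul (.coord _)).mul (.const _))).add
        ((((IsPolyFun.coord _).mul (.coord _)).sub ((IsPolyFun.coord _).mul (.coord _))).mul
          (.const _)))
    fun x hx => ⟨flowV3 hn hK x, flowV3_zero hn hK x, flowV3_mem hn hK hx, hasDerivAt_flowV3 hn hK x⟩

theorem holoFieldV1_isComplete (a : Fin 2 → ℂ) : (holoFieldV1 hn hK a).IsComplete := by
  unfold holoFieldV1
  apply HoloVF.isComplete_ofFlow

theorem holoFieldV3_isComplete (a : Fin 2 → ℂ) : (holoFieldV3 hn hK a).IsComplete := by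
  unfold holoFieldV3
  apply HoloVF.isComplete_ofFlow

end GVTwoTwo

/-! ### Assembling the compatible tuples. -/

section MainResults

/-- `V₂` kills the `z`'s, `V₃` kills `w₁`, and `V₁` kills `w₂` and `w₃`. The edges to the root `V₁`
carry `w₃` for `V₂`, with derivative `z₂²`, and `w₂` for `V₃`, with derivative `-w₁z₃`; each
derivative is constant along the respective flow. -/
theorem exists_compatible_triple (hn hK : 2 ≤ 2) (a : Fin 2 → ℂ) :
    ∃ θ : Fin 3 → HoloVF (gvVariety 2 2 a), (∀ x, (θ 0).toFun x = fieldV1 hn hK x) ∧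
      (∀ x, (θ 1).toFun x = fieldV2 hn hK x) ∧ (∀ x, (θ 2).toFun x = fieldV3 hn hK x) ∧
      IsCompatibleTuple θ := by
  obtain ⟨J, hJ⟩ := exists_gvVariety_eq_zeroLocus (n := 2) (K := 2) a
  have hk : 1 + 1 ∈ Set.Icc 2 2 := ⟨le_rfl, le_rfl⟩
  have h01 : (0 : Fin 2) ≠ 1 := by decide
  have hV2 : ∀ x, pencilField hk 0 1 x = fieldV2 hn hK x := fun x => pencilField_one hk 0 1 x
  obtain ⟨x, hx, hxz, -⟩ := exists_mem_gvVariety hK a 0 0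
  obtain ⟨y, hy, hyz, -⟩ := exists_mem_gvVariety hK a 1 0
  have hxz2 : x (idxZ2 hn) = 1 := hxz 0
  have hyz2 : y (idxZ2 hn) = 0 := hyz 0
  have hyz3 : y (idxZ3 hn) = 1 := hyz 1
  obtain ⟨x', hx', hz3, hw1⟩ : ∃ x' ∈ gvVariety 2 2 a, x' (idxZ3 hn) = 1 ∧
      x' (idxW1 hn hK) ≠ 0 := by
    -- At `y` one has `z₂ = 0`, so `w₁` drops out of the equations and may be set to `1`; then `w₁z₃
    -- ≠ 0`.
    refine ⟨Function.update y (idxW1 hn hK) 1, ?_, ?_, ?_⟩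
    · rw [mem_gvVariety_two_two hn hK] at hy ⊢
      rw [hyz2] at hy
      have e1 : Function.update y (idxW1 hn hK) 1 (idxZ2 hn) = 0 := by
        rw [Function.update_of_ne, hyz2]
        simp [idxZ2, idxW1, zIdx, wIdx]
      rw [e1, Function.update_of_ne (a := idxZ3 hn), Function.update_of_ne (a := idxW2 hn hK),
        Function.update_of_ne (a := idxW3 hn hK)]
      · simpa using hy
      · simp [idxW1, idxW3, wIdx]
      · simp [idxW1, idxW2, wIdx]
      · simp [idxZ3, idxW1, zIdx, wIdx]
    · rw [Function.update_of_ne, hyz3]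
      simp [idxZ3, idxW1, zIdx, wIdx]
    · simp
  have hV1w2 : ∀ x, fieldV1 hn hK x (idxW2 hn hK) = 0 := fun x => by
    simp [fieldV1, coordVec, idxZ2, idxZ3, idxW1, idxW2, zIdx, wIdx]
  have hV1w3 : ∀ x, fieldV1 hn hK x (idxW3 hn hK) = 0 := fun x => by
    simp [fieldV1, coordVec, idxZ2, idxZ3, idxW1, idxW3, zIdx, wIdx]
  have hV2w3 : fieldV2 hn hK x (idxW3 hn hK) ≠ 0 := by
    simp [fieldV2, coordVec, idxW1, idxW2, idxW3, wIdx, hxz2]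
  have hV2z : ∀ x j, fieldV2 hn hK x (Sum.inl j) = 0 := fun x j => by
    simp [fieldV2, coordVec, idxW1, idxW2, idxW3, wIdx]
  have hV3z2 : fieldV3 hn hK x' (idxZ2 hn) ≠ 0 := by
    have h : x' (Sum.inl 1) = 1 := hz3
    simp [fieldV3, coordVec, idxZ2, idxZ3, idxW2, idxW3, zIdx, wIdx, h]
  have hV3w1 : ∀ x, fieldV3 hn hK x (idxW1 hn hK) = 0 := fun x => by
    simp [fieldV3, coordVec, idxZ2, idxW1, idxW2, idxW3, zIdx, wIdx]
  have hV3w2 : ∀ x, fieldV3 hn hK x (idxW2 hn hK) = -(x (idxW1 hn hK) * x (idxZ3 hn)) := fun x => by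
    simp [fieldV3, coordVec, idxZ2, idxZ3, idxW1, idxW2, idxW3, zIdx, wIdx]
  have hV3w2' : fieldV3 hn hK x' (idxW2 hn hK) ≠ 0 := by
    rw [hV3w2, hz3, mul_one]
    exact neg_ne_zero.2 hw1
  have hne : ∀ {θ θ' : HoloVF (gvVariety 2 2 a)} (z : gvVariety 2 2 a) (c : GVIndex 2 2),
      θ.toFun z c = 0 → θ'.toFun z c ≠ 0 → θ ≠ θ' := by
    rintro θ _ z c h h' rfl
    exact h' h
  have h12 : holoFieldV1 hn hK a ≠ holoPencilField hk h01 a :=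
    hne ⟨x, hx⟩ (idxW3 hn hK) (hV1w3 x) (ne_of_eq_of_ne (congrFun (hV2 x) _) hV2w3)
  have h13 : holoFieldV1 hn hK a ≠ holoFieldV3 hn hK a :=
    hne ⟨x', hx'⟩ (idxW2 hn hK) (hV1w2 x') hV3w2'
  have h23 : holoPencilField hk h01 a ≠ holoFieldV3 hn hK a :=
    hne ⟨x', hx'⟩ (idxZ2 hn) ((congrFun (hV2 x') _).trans (hV2z x' _)) hV3z2
  refine ⟨![holoFieldV1 hn hK a, holoPencilField hk h01 a, holoFieldV3 hn hK a], fun _ => rfl,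
    fun x => hV2 x, fun _ => rfl, ?_⟩
  refine isCompatibleTuple_of_coordFun J hJ ⟨x, hx⟩ (fun i => ?_) (fun i j hij => ?_) (fun c => ?_)
    fun i hi => ?_
  · fin_cases i
    · exact holoFieldV1_isComplete hn hK a
    · exact holoPencilField_isComplete hk h01 a
    · exact holoFieldV3_isComplete hn hK a
  · fin_cases i <;> fin_cases j
    · rfl
    · exact absurd hij h12
    · exact absurd hij h13
    · exact absurd hij h12.symm
    · rfl
    · exact absurd hij h23
    · exact absurd hij h13.symm
    · exact absurd hij h23.symm
    · rfl
  · rcases c with j | ⟨⟨k, hk2⟩, e⟩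
    · exact ⟨1, fun z => (congrFun (hV2 z) _).trans (hV2z z j)⟩
    · obtain rfl : k = 2 := le_antisymm hk2.2 hk2.1
      induction e using Sym2.inductionOn with
      | hf i j =>
        fin_cases i <;> fin_cases j
        · exact ⟨2, fun z => hV3w1 z⟩
        · exact ⟨0, fun z => hV1w2 z⟩
        · refine ⟨0, fun z => ?_⟩
          have := hV1w2 z
          rwa [idxW2, wIdx, Sym2.eq_swap] at this
        · exact ⟨0, fun z => hV1w3 z⟩
  · fin_cases i
    · exact absurd rfl hi
    · exact ⟨idxW3 hn hK, fun z => hV1w3 z,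
        ⟨⟨x, hx⟩, ne_of_eq_of_ne (congrFun (hV2 x) _) hV2w3⟩,
        holoPencilField_flow hk h01 a (idxW3 hn hK)⟩
    · refine ⟨idxW2 hn hK, fun z => hV1w2 z, ⟨⟨x', hx'⟩, hV3w2'⟩, fun z =>
        ⟨fun t => ⟨flowV3 hn hK z t, flowV3_mem hn hK z.2 t⟩, Subtype.ext (flowV3_zero hn hK z), ?_,
          fun t => ?_⟩⟩
      · have := hasDerivAt_flowV3 hn hK (z : GVIndex 2 2 → ℂ) 0
        rw [flowV3_zero] at this
        exact this
      · refine (hV3w2 _).trans (Eq.trans ?_ (hV3w2 z).symm)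
        exact congrArg₂ (fun u v => -(u * v)) (flowV3_idxW1 hn hK z t) (flowV3_idxZ3 hn hK z t)

theorem exists_compatible_pair_fieldGamma {n K : ℕ} (hn : 2 ≤ n) (hK : 2 ≤ K) (a : Fin n → ℂ)
    (h3 : 3 ≤ n) : ∃ θ : Fin 2 → HoloVF (gvVariety n K a),
      (∀ x, (θ 0).toFun x = fieldV hn hK x) ∧ (∀ x, (θ 1).toFun x = fieldGamma h3 hK x) ∧
      IsCompatibleTuple θ := by
  have hk : 1 + 1 ∈ Set.Icc 2 K := ⟨le_rfl, hK⟩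
  let p : Fin n := ⟨1, by omega⟩
  let q : Fin n := ⟨2, by omega⟩
  obtain ⟨x, hx, hxz, -⟩ := exists_mem_gvVariety hK a p p
  have hmem : ∀ i j : Fin n, (j : ℕ) ≠ 0 → zCoord hk i j ∉ Set.range (yIdx hn hK) := by
    intro i j hj h
    have := congrArg Prod.snd (inr_mem_range_yIdx hn hK h)
    simp only [Sym2.eq_iff, Fin.ext_iff] at this
    omega
  have hp : activeHalf (1 + 1) (gvMap (gvSeq x) 1) p ≠ 0 := by
    rw [gvMap_gvSeq_one]
    simp [activeHalf, hxz]
  obtain ⟨θ, h0, h1, h⟩ := exists_compatible_pair hn hK a hk (p := p) (q := q)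
    (by simp [p, q]) (hmem _ _ (by simp [p])) (hmem _ _ (by simp [q])) (hmem _ _ (by simp [q])) hx
    (Or.inl hp)
  exact ⟨θ, h0, fun z => (h1 z).trans (pencilField_one hk p q z), h⟩

theorem exists_compatible_pair_fieldGammaTilde {K : ℕ} (hn : 2 ≤ 2) (hK : 2 ≤ K) {a : Fin 2 → ℂ}
    (ha : a ≠ 0) (h3 : 3 ≤ K) : ∃ θ : Fin 2 → HoloVF (gvVariety 2 K a),
      (∀ x, (θ 0).toFun x = fieldV hn hK x) ∧ (∀ x, (θ 1).toFun x = fieldGammaTilde hn h3 x) ∧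
      IsCompatibleTuple θ := by
  have hk : 2 + 1 ∈ Set.Icc 2 K := ⟨by omega, h3⟩
  obtain ⟨x, hx, -, hx2⟩ := exists_mem_gvVariety hK a 0 0
  have hmem : ∀ i j : Fin 2, zCoord hk i j ∉ Set.range (yIdx hn hK) := by
    intro i j h
    have := congrArg (fun e => (e.1 : ℕ)) (inr_mem_range_yIdx hn hK h)
    simp at this
  have hp : activeHalf (2 + 1) (gvMap (gvSeq x) 2) 0 ≠ 0 ∨
      activeHalf (2 + 1) (gvMap (gvSeq x) 2) 1 ≠ 0 := by
    simp only [activeHalf, if_neg (show ¬ Even (2 + 1) by decide), hx2]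
    -- At the chosen point the second half of `P²` is `a` for even `K`, where `a ≠ 0` enters, and a
    -- basis vector for odd `K`.
    by_cases hE : Even K
    · simp only [if_pos hE]
      by_contra! h
      exact ha (funext (Fin.forall_fin_two.2 h))
    · simp [hE]
  obtain ⟨θ, h0, h1, h⟩ := exists_compatible_pair hn hK a hk (p := 0) (q := 1) zero_ne_one
    (hmem _ _) (hmem _ _) (hmem _ _) hx hp
  refine ⟨θ, h0, fun z => ?_, h⟩
  rw [h1, pencilField_two]
  rfl

end MainResults

theorem mainTheorem10 (n K : ℕ) (hn : 2 ≤ n) (hK : 2 ≤ K) (a : Fin n → ℂ) (ha : a ≠ 0)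
    (hsmooth : GVSmooth n K a) :
    -- there is a compatible `k`-tuple with `k = 2` or `k = 3`
    ((∃ θ : Fin 2 → HoloVF (gvVariety n K a), IsCompatibleTuple θ) ∨
      (∃ θ : Fin 3 → HoloVF (gvVariety n K a), IsCompatibleTuple θ)) ∧
    -- `n ≥ 3`: the pair `(V, γ)`
    (∀ h3 : 3 ≤ n, ∃ θ : Fin 2 → HoloVF (gvVariety n K a),
      (∀ x, (θ 0).toFun x = fieldV hn hK x) ∧
      (∀ x, (θ 1).toFun x = fieldGamma h3 hK x) ∧
      IsCompatibleTuple θ) ∧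
    -- `n = 2` and `K ≥ 3`: the pair `(V, γ̃)`
    (n = 2 → ∀ h3 : 3 ≤ K, ∃ θ : Fin 2 → HoloVF (gvVariety n K a),
      (∀ x, (θ 0).toFun x = fieldV hn hK x) ∧
      (∀ x, (θ 1).toFun x = fieldGammaTilde hn h3 x) ∧
      IsCompatibleTuple θ) ∧
    -- `n = K = 2`: the variety is `{Wz = b}` with `b = a - e₂ ≠ 0`, and the triple `(V₁, V₂, V₃)`
    (n = 2 → K = 2 →
      a - lastVec n ≠ 0 ∧
      (∀ x : GVIndex n K → ℂ, x ∈ gvVariety n K a ↔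
        x (idxW1 hn hK) * x (idxZ2 hn) + x (idxW2 hn hK) * x (idxZ3 hn)
            = (a - lastVec n) ⟨0, by omega⟩ ∧
          x (idxW2 hn hK) * x (idxZ2 hn) + x (idxW3 hn hK) * x (idxZ3 hn)
            = (a - lastVec n) ⟨1, by omega⟩) ∧
      ∃ θ : Fin 3 → HoloVF (gvVariety n K a),
        (∀ x, (θ 0).toFun x = fieldV1 hn hK x) ∧
        (∀ x, (θ 1).toFun x = fieldV2 hn hK x) ∧
        (∀ x, (θ 2).toFun x = fieldV3 hn hK x) ∧
        IsCompatibleTuple θ) := by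
  have hgamma : ∀ h3 : 3 ≤ n, ∃ θ : Fin 2 → HoloVF (gvVariety n K a),
      (∀ x, (θ 0).toFun x = fieldV hn hK x) ∧ (∀ x, (θ 1).toFun x = fieldGamma h3 hK x) ∧
      IsCompatibleTuple θ := exists_compatible_pair_fieldGamma hn hK a
  have htilde : n = 2 → ∀ h3 : 3 ≤ K, ∃ θ : Fin 2 → HoloVF (gvVariety n K a),
      (∀ x, (θ 0).toFun x = fieldV hn hK x) ∧ (∀ x, (θ 1).toFun x = fieldGammaTilde hn h3 x) ∧
      IsCompatibleTuple θ := by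
    rintro rfl h3
    exact exists_compatible_pair_fieldGammaTilde hn hK ha h3
  have htriple : n = 2 → K = 2 → ∃ θ : Fin 3 → HoloVF (gvVariety n K a),
      (∀ x, (θ 0).toFun x = fieldV1 hn hK x) ∧ (∀ x, (θ 1).toFun x = fieldV2 hn hK x) ∧
      (∀ x, (θ 2).toFun x = fieldV3 hn hK x) ∧ IsCompatibleTuple θ := by
    rintro rfl rfl
    exact exists_compatible_triple hn hK a
  refine ⟨?_, hgamma, htilde, fun h2 hK2 => ⟨?_, ?_, htriple h2 hK2⟩⟩
  · rcases hn.lt_or_eq with h | h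
    · obtain ⟨θ, -, -, hθ⟩ := hgamma h
      exact Or.inl ⟨θ, hθ⟩
    · rcases hK.lt_or_eq with h' | h'
      · obtain ⟨θ, -, -, hθ⟩ := htilde h.symm h'
        exact Or.inl ⟨θ, hθ⟩
      · obtain ⟨θ, -, -, -, hθ⟩ := htriple h.symm h'.symm
        exact Or.inr ⟨θ, hθ⟩
  · subst h2 hK2
    exact sub_lastVec_ne_zero_of_gvSmooth hsmooth
  · subst h2 hK2
    exact mem_gvVariety_two_two hn hK a
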